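/- **Theorem ($q$-denominator conjecture).** Let $A$ be an even integer and $r\ge 1$ an integer with $A>2r$, and put $\alpha=-A/8-r^2/2$. There exist real numbers $\beta,\gamma$, depending only on $A$ and $r$, such that for every integer $n\ge 0$ $$q^{\lfloor \alpha n^2+\beta n+\gamma\rfloor}\, d_n(1/q)^{A-1}\,\hat P_{0,n}(q)\in\mathbb Z\left[\frac1q\right].$$ Here $q$ is an indeterminate, the membership is in the field $\mathbb Q(q)$, $d_n(q)\in\mathbb Z[q]$ is the monic least common multiple of $q-1,q^2-1,\dots,q^n-1$ (so $d_0=1$), and $\hat P_{0,n}(q)\in\mathbb Q(q)$ is defined as follows. Write $(a)_k=(a;q)_k=\prod_{i=0}^{k-1}(1-aq^i)$ and $$\tilde R_n(T;q)=T^{(A-2r)n/2+A/2-2}\,q^{-An(n+1)/2}\,\frac{(q)_n^{A-2r}\,(q^{-rn}T)_{rn}\,(q^{n+1}T)_{rn}}{(T-1)^A(T-q^{-1})^A\cdots(T-q^{-n})^A},$$ and let $\tilde c_{s,j,n}(q)\in\mathbb Q(q)$ be the coefficients of its partial fraction decomposition in $T$, $$\tilde R_n(T;q)=\sum_{s=1}^A\sum_{j=0}^n\frac{\tilde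 c_{s,j,n}(q)}{(T-q^{-j})^s}.$$ Put $$\tilde P_{0,n}(z,q)=-\sum_{s=1}^A\sum_{j=1}^n\sum_{k=1}^j(-1)^s\frac{q^{k-j(1-s)}}{(1-q^k)^s}\,\tilde c_{s,j,n}(q)\,z^{j-k},\qquad \tilde P_{1,n}(z,q)=-\sum_{j=0}^n \tilde c_{1,j,n}(q)\,z^j,$$ $$\hat P_{0,n}(q)=\tilde P_{0,n}(1,q)-q^{-n(r-1)}\tilde P_{0,n}(1,1/q)-\left[\frac{d}{dz}\tilde P_{1,n}(z,q)\right]_{z=1}.$$ (Background, not part of the claim: $\hat P_{0,n}(q)$ is the rational term in the expansion, for $|q|<1$, of the very-well-poised series $\tilde S_n(q)=\sum_{k\ge1}q^k(1-q^{2k+n})\tilde R_n(q^k;q)$ as $\hat P_{0,n}(q)+\sum_{3\le j\le A-1,\ j\text{ odd}}\hat P_{j,n}(q)\,\zeta_q(j)$, where $\zeta_q(j)=\sum_{k\ge1}k^{j-1}q^k/(1-q^k)$.) -/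

import Mathlib

noncomputable section

namespace QDenominators

open scoped RatFunc

/-- The `q`-shifted factorial `(a; q)_k = (1 - a)(1 - a q) ⋯ (1 - a q^(k-1))`. -/
def qPoch {R : Type*} [CommRing R] (a q : R) (k : ℕ) : R :=
  ∏ i ∈ Finset.range k, (1 - a * q ^ i)

/-- `d_n = lcm (X - 1, X² - 1, …, Xⁿ - 1)` in `ℤ[X]`, normalised to be monic. -/
def dPoly (n : ℕ) : Polynomial ℤ :=
  (Finset.Icc 1 n).lcm fun i => (Polynomial.X ^ i - 1 : Polynomial ℤ)

variable {K : Type*} [Field K]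

/-- The rational function, in the indeterminate `T` and over a field `K` containing `q`,
`T^((A-2r)n/2 + A/2 - 2) q^(-An(n+1)/2) (q;q)_n^(A-2r) (q^(-rn) T; q)_{rn} (q^(n+1) T; q)_{rn}
  / ((T - 1)^A (T - q^(-1))^A ⋯ (T - q^(-n))^A)`.
For `A` even and `A ≥ 4` the divisions and the subtractions in the exponents are exact. -/
def Rtilde (A r n : ℕ) (q : K) : RatFunc K :=
  RatFunc.X ^ ((A - 2 * r) * n / 2 + A / 2 - 2)
    * RatFunc.C (q ^ (-((A * n * (n + 1) / 2 : ℕ) : ℤ)))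
    * (RatFunc.C (qPoch q q n ^ (A - 2 * r))
      * qPoch (RatFunc.C (q ^ (-((r * n : ℕ) : ℤ))) * RatFunc.X) (RatFunc.C q) (r * n)
      * qPoch (RatFunc.C (q ^ (n + 1)) * RatFunc.X) (RatFunc.C q) (r * n))
    / ∏ i ∈ Finset.range (n + 1), (RatFunc.X - RatFunc.C (q ^ (-(i : ℤ)))) ^ A

/-- The coefficient `c_{s,j,n}(q)` of `1 / (T - q^(-j))^s` in the partial fraction decomposition
of `Rtilde A r n q`, that is, the coefficient of `(T - q^(-j))^(-s)` in its Laurent expansion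
at `T = q^(-j)`. -/
def ctilde (A r s j n : ℕ) (q : K) : K :=
  HahnSeries.coeff
    (algebraMap (RatFunc K) (LaurentSeries K)
      (RatFunc.laurent (q ^ (-(j : ℤ))) (Rtilde A r n q)))
    (-(s : ℤ))

/-- The polynomial in `z`
`-∑_{s=1}^A ∑_{j=1}^n ∑_{k=1}^j (-1)^s q^(k - j(1-s)) / (1 - q^k)^s c_{s,j,n}(q) z^(j-k)`. -/
def P0tilde (A r n : ℕ) (q : K) : Polynomial K :=
  -∑ s ∈ Finset.Icc 1 A, ∑ j ∈ Finset.Icc 1 n, ∑ k ∈ Finset.Icc 1 j,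
    Polynomial.C ((-1) ^ s * (q ^ ((k : ℤ) - (j : ℤ) * (1 - (s : ℤ))) / (1 - q ^ k) ^ s)
      * ctilde A r s j n q) * Polynomial.X ^ (j - k)

/-- The polynomial in `z`, for `s ≥ 1`:
`(-1)^s ∑_{j=0}^n q^(j(s-1)) c_{s,j,n}(q) z^j`. -/
def Ptilde (A r s n : ℕ) (q : K) : Polynomial K :=
  (-1) ^ s * ∑ j ∈ Finset.range (n + 1),
    Polynomial.C (q ^ (j * (s - 1)) * ctilde A r s j n q) * Polynomial.X ^ j

/-- `P̂_{0,n}(q) = P̃_{0,n}(1,q) - q^(-n(r-1)) P̃_{0,n}(1,1/q) - [d/dz P̃_{1,n}(z,q)]_{z=1}`. -/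
def P0hat (A r n : ℕ) (q : K) : K :=
  (P0tilde A r n q).eval 1
    - q ^ (-((n : ℤ) * ((r : ℤ) - 1))) * (P0tilde A r n q⁻¹).eval 1
    - (Polynomial.derivative (Ptilde A r 1 n q)).eval 1

end QDenominators

end

/-! A Laurent polynomial in q over ℤ whose degree in q is at most 0 lies in ℤ[1/q]
(`mem_adjoin_X_inv`). So two facts about P̂₀ are needed: a bound on its growth as q → ∞, and a bound
on the order of its poles at roots of unity.

Both are read off `P0hat_eq`. The substitution T = q^(-j)(1+u) turns the partial fraction
coefficients into polar coefficients in u (`ctilde_eq`), and q ↦ 1/q carries the pole j to the pole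
n-j up to a power of q (`polarCoeff_inv`). Hence P̂₀ is a combination of polar coefficients times
kernels q^k/(1-q^k)^s with 1 ≤ |k| ≤ n, plus the derivative term, which involves only s = 1.

Growth: the kernels are bounded at infinity, and the polar coefficients at j are O(q^g) with g =
`growthExp`, whose quadratic part is (A/2)j(n-j) + r²n²/2. Maximising over j gives A/8 + r²/2
(`growthExp_le`).

Poles: at a primitive m-th root of unity ζ the summands have order at most A, and one order must be
gained by cancellation. Put u = (1-q^m)w and let q → ζ. After division by 1-q^m, a linear factor
with i ≡ j mod m becomes l - w with l = (i-j)/m; the other factors become constants. Counting zeros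
and poles in the residue class of j shows that the limit exists, and that it vanishes if j mod m > n
mod m or if the class contains surplus zeros. Otherwise it is, up to a constant, the series of the q
= 1 analogue with ⌊n/m⌋ in place of n, whose reflection symmetry multiplies the s-th coefficient by
(-1)^s (`rescale_redSeries`). The kernel sums tend to H_s(⌊j/m⌋) - (-1)^s H_s(⌊(n-j)/m⌋), and the
reflection makes the total cancel (`pair_pow_mul_P0hat_mem`). The remaining order A-1 is cleared by
d_n(1/q)^(A-1), since the numerator of d_n(1/q) is divisible by every Φ_m with m ≤ n. -/

noncomputable section

namespace QDenominators

open scoped RatFunc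

/-! ### Local expansion of the rational function at its poles. -/

section Expansion

variable {K : Type*} [Field K]

theorem map_qPoch {R S : Type*} [CommRing R] [CommRing S] (f : R →+* S) (a q : R) (k : ℕ) :
    f (qPoch a q k) = qPoch (f a) (f q) k := by
  simp [qPoch, map_prod]

/-- The linear factor `1 - q^k (1 + τ w)`, as a power series in `w`. -/
def ell (q τ : K) (k : ℤ) : PowerSeries K :=
  1 - PowerSeries.C (q ^ k) * (1 + PowerSeries.C τ * PowerSeries.X)

/-- The exponent of `T` in `Rtilde`. -/
def topExp (A r n : ℕ) : ℕ := (A - 2 * r) * n / 2 + A / 2 - 2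

/-- The exponents `i` of the zeros `T = q^(-i)` of `Rtilde`. -/
def zeroSet (r n : ℕ) : Finset ℤ :=
  Finset.Ico (-((r * n : ℕ) : ℤ)) 0 ∪ Finset.Ico ((n : ℤ) + 1) (n + 1 + (r * n : ℕ))

/-- The exponents `i` of the poles `T = q^(-i)` of `Rtilde` other than `T = q^(-j)`. -/
def poleSet (n : ℕ) (j : ℤ) : Finset ℤ := (Finset.Icc 0 (n : ℤ)).erase j

/-- The power series `u^A R(q^(-j) (1 + u))`, with `u = τ w`, up to the factor `τ^A`. -/
def localSeries (A r n : ℕ) (j : ℤ) (q τ : K) : PowerSeries K :=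
  PowerSeries.C (q ^ (-(j * topExp A r n)))
    * (1 + PowerSeries.C τ * PowerSeries.X) ^ topExp A r n
    * PowerSeries.C (qPoch q q n ^ (A - 2 * r))
    * (∏ i ∈ zeroSet r n, ell q τ (i - j))
    * (∏ i ∈ poleSet n j, ell q τ (i - j))⁻¹ ^ A

/-- The coefficient of `u^(-s)` in the expansion of `R(q^(-j) (1 + u))`. -/
def polarCoeff (A r n s : ℕ) (j : ℤ) (q : K) : K :=
  PowerSeries.coeff (A - s) (localSeries A r n j q 1)

theorem constantCoeff_ell (q τ : K) (k : ℤ) :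
    PowerSeries.constantCoeff (ell q τ k) = 1 - q ^ k := by
  simp [ell]

theorem rescale_C {R : Type*} [CommRing R] (a b : R) :
    PowerSeries.rescale a (PowerSeries.C b) = PowerSeries.C b := by
  ext n
  rcases eq_or_ne n 0 with rfl | h
  · simp
  · simp [PowerSeries.coeff_rescale, PowerSeries.coeff_C, h]

theorem rescale_inv {f : PowerSeries K} (a : K) (hf : PowerSeries.constantCoeff f ≠ 0) :
    PowerSeries.rescale a f⁻¹ = (PowerSeries.rescale a f)⁻¹ := by
  have h0 : PowerSeries.constantCoeff (PowerSeries.rescale a f) ≠ 0 := by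
    rw [← PowerSeries.coeff_zero_eq_constantCoeff_apply, PowerSeries.coeff_rescale]
    simpa using hf
  rw [PowerSeries.eq_inv_iff_mul_eq_one h0, ← map_mul, PowerSeries.inv_mul_cancel _ hf, map_one]

theorem rescale_ell (q τ a : K) (k : ℤ) :
    PowerSeries.rescale a (ell q τ k) = ell q (τ * a) k := by
  simp [ell, rescale_C, PowerSeries.rescale_X, mul_assoc]

theorem constantCoeff_prod_ell_ne_zero {q : K} (hq : ∀ k : ℤ, k ≠ 0 → q ^ k ≠ 1) (τ : K) (n : ℕ)
    (j : ℤ) : PowerSeries.constantCoeff (∏ i ∈ poleSet n j, ell q τ (i - j)) ≠ 0 := by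
  rw [map_prod, Finset.prod_ne_zero_iff]
  intro i hi
  rw [constantCoeff_ell, sub_ne_zero]
  refine (hq _ ?_).symm
  simp only [poleSet, Finset.mem_erase] at hi
  omega

theorem rescale_localSeries {q : K} (hq : ∀ k : ℤ, k ≠ 0 → q ^ k ≠ 1) (A r n : ℕ) (j : ℤ)
    (τ : K) : PowerSeries.rescale τ (localSeries A r n j q 1) = localSeries A r n j q τ := by
  simp only [localSeries, map_mul, map_pow, map_prod, map_add, map_one, rescale_C,
    PowerSeries.rescale_X, one_mul, rescale_ell,
    rescale_inv τ (constantCoeff_prod_ell_ne_zero hq 1 n j)]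

/-- The parameter τ is later 1 - q^m: the polar coefficients, weighted by the power of 1 - q^m that
makes them regular at a root of unity, become coefficients of one series that can be reduced there.
-/
theorem coeff_localSeries {q : K} (hq : ∀ k : ℤ, k ≠ 0 → q ^ k ≠ 1) (A r n s : ℕ) (j : ℤ)
    (τ : K) : PowerSeries.coeff (A - s) (localSeries A r n j q τ)
      = τ ^ (A - s) * polarCoeff A r n s j q := by
  rw [← rescale_localSeries hq, PowerSeries.coeff_rescale, polarCoeff]

theorem prod_range_int {M : Type*} [CommMonoid M] (f : ℤ → M) (c : ℤ) (a : ℕ) :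
    ∏ i ∈ Finset.range a, f (c + i) = ∏ i ∈ Finset.Ico c (c + a), f i := by
  refine Finset.prod_nbij (fun i : ℕ => c + i) ?_ ?_ ?_ ?_
  · intro i hi
    simp only [Finset.mem_range, Finset.mem_Ico] at hi ⊢
    omega
  · intro x _ y _ h
    simpa using h
  · intro x hx
    simp only [Finset.coe_Ico, Set.mem_Ico] at hx
    refine ⟨(x - c).toNat, ?_, ?_⟩
    · simp only [Finset.coe_range, Set.mem_Iio]; omega
    · simp only []; omega
  · intro i _; rfl

theorem prod_zeroSet {M : Type*} [CommMonoid M] (f : ℤ → M) (r n : ℕ) :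
    ∏ i ∈ zeroSet r n, f i =
      (∏ i ∈ Finset.range (r * n), f (-((r * n : ℕ) : ℤ) + i))
        * ∏ i ∈ Finset.range (r * n), f ((n : ℤ) + 1 + i) := by
  rw [zeroSet, Finset.prod_union, prod_range_int, prod_range_int, neg_add_cancel]
  rw [Finset.disjoint_left]
  intro x hx hy
  simp only [Finset.mem_Ico] at hx hy
  omega

theorem prod_poleSet {M : Type*} [CommMonoid M] (f : ℤ → M) (n j : ℕ) :
    ∏ i ∈ poleSet n j, f i = ∏ i ∈ (Finset.range (n + 1)).erase j, f i := by
  symm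
  refine Finset.prod_nbij (fun i : ℕ => (i : ℤ)) ?_ ?_ ?_ ?_
  · intro i hi
    simp only [poleSet, Finset.mem_range, Finset.mem_erase, Finset.mem_Icc] at hi ⊢
    omega
  · intro x _ y _ h
    simpa using h
  · intro x hx
    simp only [poleSet, Finset.coe_erase, Finset.coe_Icc, Set.mem_sdiff, Set.mem_Icc,
      Set.mem_singleton_iff] at hx
    refine ⟨x.toNat, ?_, ?_⟩
    · simp only [Finset.coe_erase, Finset.coe_range, Set.mem_sdiff, Set.mem_Iio,
        Set.mem_singleton_iff]
      omega
    · simp only []; omega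
  · intro i _; rfl

/-- The homomorphism taking the Laurent expansion at `T = a`. -/
def expandAt (a : K) : RatFunc K →+* LaurentSeries K :=
  (algebraMap (RatFunc K) (LaurentSeries K)).comp (RatFunc.laurent a : RatFunc K →+* RatFunc K)

theorem expandAt_C (a c : K) :
    expandAt a (RatFunc.C c) = HahnSeries.ofPowerSeries ℤ K (PowerSeries.C c) := by
  change algebraMap (RatFunc K) (LaurentSeries K) (RatFunc.laurent a (RatFunc.C c)) = _
  rw [RatFunc.laurent_C, ← RatFunc.algebraMap_C]
  exact (RatFunc.coe_coe (Polynomial.C c)).symm.trans (by rw [Polynomial.coe_C])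

theorem expandAt_X (a : K) :
    expandAt a RatFunc.X
      = HahnSeries.ofPowerSeries ℤ K (PowerSeries.X + PowerSeries.C a) := by
  have h : expandAt a RatFunc.X
      = algebraMap (RatFunc K) (LaurentSeries K) RatFunc.X + expandAt a (RatFunc.C a) := by
    change algebraMap (RatFunc K) (LaurentSeries K) (RatFunc.laurent a RatFunc.X)
      = _ + algebraMap (RatFunc K) (LaurentSeries K) (RatFunc.laurent a (RatFunc.C a))
    rw [RatFunc.laurent_X, RatFunc.laurent_C, map_add]
  rw [h, expandAt_C, map_add, HahnSeries.ofPowerSeries_X]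
  congr 1
  exact RatFunc.coe_X

theorem prod_zpow_range_erase {q : K} (hq0 : q ≠ 0) (n j : ℕ) (hj : j ≤ n) :
    q ^ (j : ℤ) * q ^ (-((n * (n + 1) / 2 : ℕ) : ℤ))
      = ∏ i ∈ (Finset.range (n + 1)).erase j, q ^ (-(i : ℤ)) := by
  have h := Finset.mul_prod_erase (Finset.range (n + 1)) (fun i : ℕ => q ^ (-(i : ℤ)))
    (a := j) (by simpa using Nat.lt_succ_of_le hj)
  have h2 : ∏ i ∈ Finset.range (n + 1), q ^ (-(i : ℤ)) = q ^ (-((n * (n + 1) / 2 : ℕ) : ℤ)) := by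
    have h3 : (n * (n + 1) / 2) = ∑ i ∈ Finset.range (n + 1), i := by
      rw [Finset.sum_range_id, Nat.add_sub_cancel, mul_comm]
    rw [h3]
    clear h h3
    induction n + 1 with
    | zero => simp
    | succ k ih => 
      rw [Finset.prod_range_succ, ih, ← zpow_add₀ hq0, Finset.sum_range_succ]
      push_cast
      ring_nf
  rw [← h2, ← h, ← mul_assoc, ← zpow_add₀ hq0]
  simp

/-- With T = q^(-j)(1+u) one has T - q^(-j) = q^(-j)u, whence the factor q^(-js). Pulling q^(-i) out
of each T - q^(-i) uses up the prefactor q^(-An(n+1)/2), and the signs disappear because A is even.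
-/
theorem ctilde_eq {q : K} (hq0 : q ≠ 0) (hq : ∀ k : ℤ, k ≠ 0 → q ^ k ≠ 1) {A r n s j : ℕ}
    (hA : Even A) (hj : j ≤ n) (hs : s ≤ A) :
    ctilde A r s j n q = q ^ (-(j * s : ℤ)) * polarCoeff A r n s j q := by
  set a : K := q ^ (-(j : ℤ)) with ha
  set Y : PowerSeries K := PowerSeries.X + PowerSeries.C a with hY
  set num : PowerSeries K := Y ^ topExp A r n
    * PowerSeries.C (q ^ (-((A * n * (n + 1) / 2 : ℕ) : ℤ)))
    * (PowerSeries.C (qPoch q q n ^ (A - 2 * r))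
      * qPoch (PowerSeries.C (q ^ (-((r * n : ℕ) : ℤ))) * Y) (PowerSeries.C q) (r * n)
      * qPoch (PowerSeries.C (q ^ (n + 1)) * Y) (PowerSeries.C q) (r * n)) with hnum
  set D : PowerSeries K := ∏ i ∈ (Finset.range (n + 1)).erase j,
    (Y - PowerSeries.C (q ^ (-(i : ℤ)))) ^ A with hD
  have hD0 : PowerSeries.constantCoeff D ≠ 0 := by
    rw [hD, map_prod, Finset.prod_ne_zero_iff]
    intro i hi
    simp only [Finset.mem_erase] at hi
    rw [map_pow]
    refine pow_ne_zero _ ?_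
    simp only [hY, map_sub, map_add, PowerSeries.constantCoeff_X, PowerSeries.constantCoeff_C,
      zero_add, sub_ne_zero, ha]
    intro h
    refine hq ((i : ℤ) - j) (by omega) ?_
    rw [sub_eq_add_neg, zpow_add₀ hq0, h, ← zpow_add₀ hq0]
    simp
  have hden : (∏ i ∈ Finset.range (n + 1), (Y - PowerSeries.C (q ^ (-(i : ℤ)))) ^ A)
      = PowerSeries.X ^ A * D := by
    rw [← Finset.mul_prod_erase (Finset.range (n + 1)) _
      (a := j) (by simpa using Nat.lt_succ_of_le hj), hD]
    simp [hY, ha]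
  have hexp : expandAt a (Rtilde A r n q)
      = HahnSeries.single (-(A : ℤ)) 1 * HahnSeries.ofPowerSeries ℤ K (num * D⁻¹) := by
    have h1 : expandAt a (Rtilde A r n q)
        = HahnSeries.ofPowerSeries ℤ K num / HahnSeries.ofPowerSeries ℤ K (PowerSeries.X ^ A * D) := by
      rw [← hden, Rtilde]
      simp only [map_div₀, map_mul, map_pow, map_qPoch, map_prod, map_sub, expandAt_C, expandAt_X,
        hnum, topExp, ← hY]
    have hD' : D ≠ 0 := by rintro h; simp [h] at hD0
    rw [h1, div_eq_iff]
    · rw [mul_assoc, ← map_mul]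
      have : num * D⁻¹ * (PowerSeries.X ^ A * D) = PowerSeries.X ^ A * num := by
        rw [show num * D⁻¹ * (PowerSeries.X ^ A * D) = PowerSeries.X ^ A * num * (D⁻¹ * D) by ring,
          PowerSeries.inv_mul_cancel _ hD0, mul_one]
      rw [this, map_mul _ (PowerSeries.X ^ A), ← mul_assoc, map_pow, HahnSeries.ofPowerSeries_X, HahnSeries.single_pow]
      simp
    · rw [Ne, map_eq_zero_iff _ HahnSeries.ofPowerSeries_injective]
      exact mul_ne_zero (pow_ne_zero _ PowerSeries.X_ne_zero) hD'
  have hc : ctilde A r s j n q = PowerSeries.coeff (A - s) (num * D⁻¹) := by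
    have : ctilde A r s j n q = (expandAt a (Rtilde A r n q)).coeff (-(s : ℤ)) := rfl
    rw [this, hexp]
    rw [show (-(s : ℤ)) = ((A - s : ℕ) : ℤ) + (-(A : ℤ)) by omega, HahnSeries.coeff_single_mul_add,
      one_mul]
    exact HahnSeries.ofPowerSeries_apply_coeff _ _
  have hYr : PowerSeries.rescale a Y = PowerSeries.C a * (1 + PowerSeries.X) := by
    rw [hY, map_add, PowerSeries.rescale_X, rescale_C]
    ring
  have hell : ∀ k : ℤ, 1 - PowerSeries.C (q ^ k) * PowerSeries.rescale a Y = ell q 1 (k - j) := by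
    intro k
    rw [hYr, ell, sub_eq_add_neg k, zpow_add₀ hq0, ← ha, map_mul, map_one]
    ring
  have hfac : ∀ i : ℕ, (PowerSeries.rescale a Y - PowerSeries.C (q ^ (-(i : ℤ)))) ^ A
      = PowerSeries.C (q ^ (-(i : ℤ))) ^ A * ell q 1 (i - j) ^ A := by
    intro i
    rw [← mul_pow, ← hell, mul_sub, ← mul_assoc, ← map_mul, ← zpow_add₀ hq0, ← hA.neg_pow]
    simp
  have hDr : PowerSeries.rescale a D
      = PowerSeries.C (q ^ (j * A : ℤ) * q ^ (-((A * n * (n + 1) / 2 : ℕ) : ℤ)))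
        * (∏ i ∈ poleSet n j, ell q 1 (i - j)) ^ A := by
    rw [hD, map_prod]
    simp only [map_pow, map_sub, rescale_C, hfac]
    rw [Finset.prod_mul_distrib, Finset.prod_pow, Finset.prod_pow, prod_poleSet, ← map_prod,
      ← map_pow, ← prod_zpow_range_erase hq0 n j hj, mul_pow, ← zpow_natCast, ← zpow_mul,
      ← zpow_natCast, ← zpow_mul]
    have : A * n * (n + 1) / 2 = n * (n + 1) / 2 * A := by
      rw [mul_assoc, mul_comm, Nat.div_mul_right_comm]
      exact (Nat.even_mul_succ_self n).two_dvd
    rw [this]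
    push_cast
    rw [neg_mul]
  have hnr : PowerSeries.rescale a num
      = PowerSeries.C (q ^ (-((A * n * (n + 1) / 2 : ℕ) : ℤ)))
        * (PowerSeries.C (q ^ (-(j * topExp A r n : ℤ)))
    * (1 + PowerSeries.X) ^ topExp A r n
    * PowerSeries.C (qPoch q q n ^ (A - 2 * r))
    * (∏ i ∈ zeroSet r n, ell q 1 (i - j))) := by
    have hp1 : qPoch (PowerSeries.C (q ^ (-((r * n : ℕ) : ℤ))) * PowerSeries.rescale a Y)
        (PowerSeries.C q) (r * n)
        = ∏ i ∈ Finset.range (r * n), ell q 1 (-((r * n : ℕ) : ℤ) + i - j) := by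
      refine Finset.prod_congr rfl fun i _ => ?_
      rw [← hell, zpow_add₀ hq0, map_mul, zpow_natCast, map_pow]
      ring
    have hp2 : qPoch (PowerSeries.C (q ^ (n + 1)) * PowerSeries.rescale a Y)
        (PowerSeries.C q) (r * n)
        = ∏ i ∈ Finset.range (r * n), ell q 1 ((n : ℤ) + 1 + i - j) := by
      refine Finset.prod_congr rfl fun i _ => ?_
      rw [← hell, zpow_add₀ hq0, map_mul, zpow_natCast]
      have : ((n : ℤ) + 1) = (n + 1 : ℕ) := by push_cast; rfl
      rw [this, zpow_natCast, map_pow, map_pow]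
      ring
    rw [hnum]
    simp only [map_mul, map_qPoch, rescale_C]
    rw [map_pow (PowerSeries.rescale a), hp1, hp2, prod_zeroSet (fun i => ell q 1 (i - j)), hYr, mul_pow, ← map_pow, ha,
      ← zpow_natCast, ← zpow_mul, neg_mul]
    ring
  have hP0 := constantCoeff_prod_ell_ne_zero hq 1 n (j : ℤ)
  -- Rescaling by a = q^(-j) replaces T - q^(-j) by u; the factor q^(jA) comes from the A-fold pole
  -- itself.
  have hG : PowerSeries.C (q ^ (j * A : ℤ)) * PowerSeries.rescale a (num * D⁻¹)
      = localSeries A r n j q 1 := by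
    set P := ∏ i ∈ poleSet n j, ell q 1 (i - j) with hP
    have h2 : PowerSeries.rescale a (num * D⁻¹) * PowerSeries.rescale a D
        = PowerSeries.rescale a num := by
      rw [← map_mul, mul_assoc, PowerSeries.inv_mul_cancel _ hD0, mul_one]
    rw [hDr, hnr] at h2
    have hc0 : PowerSeries.C (q ^ (-((A * n * (n + 1) / 2 : ℕ) : ℤ))) ≠ 0 := by
      rw [Ne, map_eq_zero_iff _ PowerSeries.C_injective]
      exact zpow_ne_zero _ hq0
    have hPi : P ^ A * P⁻¹ ^ A = 1 := by
      rw [← mul_pow, PowerSeries.mul_inv_cancel _ hP0, one_pow]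
    apply mul_left_cancel₀ hc0
    have h3 := congrArg (· * P⁻¹ ^ A) h2
    beta_reduce at h3
    rw [localSeries, map_one, one_mul, ← hP]
    rw [← mul_assoc, ← mul_assoc, ← h3, map_mul PowerSeries.C]
    linear_combination (- (PowerSeries.C (q ^ (-((A * n * (n + 1) / 2 : ℕ) : ℤ))) *
      PowerSeries.C (q ^ (j * A : ℤ)) * PowerSeries.rescale a (num * D⁻¹))) * hPi
  rw [polarCoeff, ← hG, PowerSeries.coeff_C_mul, PowerSeries.coeff_rescale, hc, ha, ← mul_assoc,
    ← mul_assoc, ← zpow_natCast, ← zpow_mul, ← zpow_add₀ hq0, ← zpow_add₀ hq0, Nat.cast_sub hs]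
  rw [show (-(j * s : ℤ)) + j * A + -(j : ℤ) * (A - s) = 0 by ring]
  simp

end Expansion

/-! ### The symmetry q ↦ 1/q, and P̂₀ in terms of polar coefficients. -/

section Symmetry

variable {K : Type*} [Field K]

theorem prod_zeroSet_reflect {M : Type*} [CommMonoid M] (f : ℤ → M) (r n : ℕ) :
    ∏ i ∈ zeroSet r n, f (n - i) = ∏ i ∈ zeroSet r n, f i := by
  refine Finset.prod_nbij' (fun i => (n : ℤ) - i) (fun i => (n : ℤ) - i) ?_ ?_ ?_ ?_ ?_
  · intro i hi
    simp only [zeroSet, Finset.mem_union, Finset.mem_Ico] at hi ⊢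
    omega
  · intro i hi
    simp only [zeroSet, Finset.mem_union, Finset.mem_Ico] at hi ⊢
    omega
  · intro i _; ring
  · intro i _; ring
  · intro i _; rfl

theorem prod_poleSet_reflect {M : Type*} [CommMonoid M] (f : ℤ → M) (n : ℕ) (j : ℤ) :
    ∏ i ∈ poleSet n j, f (n - i) = ∏ i ∈ poleSet n (n - j), f i := by
  refine Finset.prod_nbij' (fun i => (n : ℤ) - i) (fun i => (n : ℤ) - i) ?_ ?_ ?_ ?_ ?_
  · intro i hi
    simp only [poleSet, Finset.mem_erase, Finset.mem_Icc] at hi ⊢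
    omega
  · intro i hi
    simp only [poleSet, Finset.mem_erase, Finset.mem_Icc] at hi ⊢
    omega
  · intro i _; ring
  · intro i _; ring
  · intro i _; rfl

theorem ell_inv (q τ : K) (k : ℤ) : ell q⁻¹ τ k = ell q τ (-k) := by
  simp [ell]

/-- Squaring removes the sign (-1)^n; only the even power A - 2r of (q)_n occurs. -/
theorem qPoch_inv_sq {q : K} (hq0 : q ≠ 0) (n : ℕ) :
    qPoch q⁻¹ q⁻¹ n ^ 2 = q ^ (-(n * (n + 1) : ℤ)) * qPoch q q n ^ 2 := by
  induction n with
  | zero => simp [qPoch]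
  | succ n ih =>
    have h : ∀ x : K, qPoch x x (n + 1) = qPoch x x n * (1 - x ^ (n + 1)) := by
      intro x
      rw [qPoch, Finset.prod_range_succ, qPoch, pow_succ' x n]
    have h2 : (1 - q⁻¹ ^ (n + 1)) ^ 2 = q ^ (-(2 * (n + 1) : ℤ)) * (1 - q ^ (n + 1)) ^ 2 := by
      rw [show (-(2 * (n + 1) : ℤ)) = -((2 * (n + 1) : ℕ) : ℤ) by push_cast; ring, zpow_neg,
        zpow_natCast]
      have := pow_ne_zero (n + 1) hq0
      rw [inv_pow, mul_comm 2, pow_mul]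
      field_simp
      ring
    rw [h, h, mul_pow, mul_pow, ih, h2]
    rw [show (-(((n + 1 : ℕ) : ℤ) * ((n + 1 : ℕ) + 1)))
      = -(n * (n + 1) : ℤ) + -(2 * (n + 1) : ℤ) by push_cast; ring, zpow_add₀ hq0]
    ring

theorem topExp_eq {a r : ℕ} (n : ℕ) (hr : r < a) (ha : 2 ≤ a) :
    (topExp (2 * a) r n : ℤ) = (a - r) * n + a - 2 := by
  have h1 : (2 * a - 2 * r) * n / 2 = (a - r) * n := by
    rw [← Nat.mul_sub, mul_assoc, Nat.mul_div_cancel_left _ two_pos]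
  have h2 : 2 * a / 2 = a := by omega
  rw [topExp, h1, h2, Nat.cast_sub (by omega)]
  push_cast [Nat.cast_sub hr.le]
  rfl

/-- Inverting q negates every exponent i - j, which the reflection i ↦ n - i undoes at the price of
moving the pole to n - j; the zeros and the full set of poles are stable under it. The power of q is
what remains from the monomial in T and from (q)_n. -/
theorem localSeries_inv {q : K} (hq0 : q ≠ 0) {A r : ℕ} (hA : Even A) (hr : 1 ≤ r)
    (hAr : 2 * r < A) (n : ℕ) (j : ℤ) (τ : K) :
    localSeries A r n j q⁻¹ τ
      = PowerSeries.C (q ^ ((r - 2) * n : ℤ)) * localSeries A r n (n - j) q τ := by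
  obtain ⟨a, rfl⟩ := hA.two_dvd
  have hra : r < a := by omega
  have hz : ∏ i ∈ zeroSet r n, ell q⁻¹ τ (i - j)
      = ∏ i ∈ zeroSet r n, ell q τ (i - (n - j)) := by
    rw [← prod_zeroSet_reflect]
    refine Finset.prod_congr rfl fun i _ => ?_
    rw [ell_inv]
    congr 1
    ring
  have hp : ∏ i ∈ poleSet n j, ell q⁻¹ τ (i - j)
      = ∏ i ∈ poleSet n (n - j), ell q τ (i - (n - j)) := by
    rw [← prod_poleSet_reflect]
    refine Finset.prod_congr rfl fun i _ => ?_
    rw [ell_inv]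
    congr 1
    ring
  have hc : q⁻¹ ^ (-(j * topExp (2 * a) r n)) * qPoch q⁻¹ q⁻¹ n ^ (2 * a - 2 * r)
      = q ^ ((r - 2) * n : ℤ) * (q ^ (-((n - j) * topExp (2 * a) r n))
        * qPoch q q n ^ (2 * a - 2 * r)) := by
    rw [← Nat.mul_sub, pow_mul, qPoch_inv_sq hq0, mul_pow, ← pow_mul, ← zpow_natCast,
      ← zpow_mul, inv_zpow', ← mul_assoc, ← zpow_add₀ hq0, ← mul_assoc, ← zpow_add₀ hq0,
      topExp_eq n hra (by omega), Nat.cast_sub hra.le]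
    congr 2
    ring
  have hc' := congrArg (PowerSeries.C (R := K)) hc
  simp only [map_mul] at hc'
  rw [localSeries, localSeries, hz, hp]
  linear_combination ((1 + PowerSeries.C τ * PowerSeries.X) ^ topExp (2 * a) r n
    * (∏ i ∈ zeroSet r n, ell q τ (i - (n - j)))
    * (∏ i ∈ poleSet n (n - j), ell q τ (i - (n - j)))⁻¹ ^ (2 * a)) * hc'

theorem polarCoeff_inv {q : K} (hq0 : q ≠ 0) {A r : ℕ} (hA : Even A) (hr : 1 ≤ r)
    (hAr : 2 * r < A) (n s : ℕ) (j : ℤ) :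
    polarCoeff A r n s j q⁻¹ = q ^ ((r - 2) * n : ℤ) * polarCoeff A r n s (n - j) q := by
  rw [polarCoeff, localSeries_inv hq0 hA hr hAr, PowerSeries.coeff_C_mul, polarCoeff]

theorem P0tilde_eval {q : K} (hq0 : q ≠ 0) (hq : ∀ k : ℤ, k ≠ 0 → q ^ k ≠ 1) {A : ℕ}
    (hA : Even A) (r n : ℕ) :
    (P0tilde A r n q).eval 1 = -∑ s ∈ Finset.Icc 1 A, ∑ j ∈ Finset.range (n + 1),
      (-1) ^ s * q ^ (-(j : ℤ)) * polarCoeff A r n s j q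
        * ∑ k ∈ Finset.Icc 1 j, q ^ (k : ℤ) / (1 - q ^ (k : ℤ)) ^ s := by
  simp only [P0tilde, Polynomial.eval_neg, Polynomial.eval_finsetSum, Polynomial.eval_mul,
    Polynomial.eval_C, Polynomial.eval_pow, Polynomial.eval_X, one_pow, mul_one]
  congr 1
  refine Finset.sum_congr rfl fun s hs => ?_
  have hss := (Finset.mem_Icc.1 hs).2
  -- The index j = 0 may be added, its sum over k being empty; the range then becomes stable under j
  -- ↦ n - j.
  rw [← Finset.sum_subset (s₁ := Finset.Icc 1 n) (s₂ := Finset.range (n + 1))]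
  · refine Finset.sum_congr rfl fun j hj => ?_
    rw [Finset.mul_sum]
    refine Finset.sum_congr rfl fun k _ => ?_
    rw [ctilde_eq hq0 hq hA (Finset.mem_Icc.1 hj).2 hss]
    have : q ^ ((k : ℤ) - j * (1 - s)) = q ^ (k : ℤ) * q ^ (-(j : ℤ)) * q ^ (j * s : ℤ) := by
      rw [← zpow_add₀ hq0, ← zpow_add₀ hq0]
      congr 1
      ring
    rw [this, zpow_natCast]
    have h3 : q ^ (j * s : ℤ) * q ^ (-(j * s : ℤ)) = 1 := by rw [← zpow_add₀ hq0]; simp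
    linear_combination ((-1) ^ s * q ^ k * q ^ (-(j : ℤ)) / (1 - q ^ k) ^ s
      * polarCoeff A r n s j q) * h3
  · intro j hj
    simp only [Finset.mem_Icc, Finset.mem_range] at hj ⊢
    omega
  · intro j hj hj'
    simp only [Finset.mem_Icc, Finset.mem_range] at hj hj'
    have : j = 0 := by omega
    simp [this]

/-- The prefactor q^(-n(r-1)) is exactly what gives both double sums the weight q^(-j) after the
symmetry and the reindexing j ↦ n - j, so that they share the same polar coefficients. -/
theorem P0hat_eq {q : K} (hq0 : q ≠ 0) (hq : ∀ k : ℤ, k ≠ 0 → q ^ k ≠ 1) {A r : ℕ}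
    (hA : Even A) (hr : 1 ≤ r) (hAr : 2 * r < A) (n : ℕ) :
    P0hat A r n q = -(∑ s ∈ Finset.Icc 1 A, ∑ j ∈ Finset.range (n + 1),
        (-1) ^ s * q ^ (-(j : ℤ)) * polarCoeff A r n s j q
          * (∑ k ∈ Finset.Icc 1 j, q ^ (k : ℤ) / (1 - q ^ (k : ℤ)) ^ s
            - ∑ k ∈ Finset.Icc 1 (n - j), q ^ (-(k : ℤ)) / (1 - q ^ (-(k : ℤ))) ^ s))
      + ∑ j ∈ Finset.range (n + 1), (j : K) * q ^ (-(j : ℤ)) * polarCoeff A r n 1 j q := by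
  have h1 : (Polynomial.derivative (Ptilde A r 1 n q)).eval 1
      = -∑ j ∈ Finset.range (n + 1), (j : K) * q ^ (-(j : ℤ)) * polarCoeff A r n 1 j q := by
    simp only [Ptilde, pow_one, Polynomial.derivative_mul, Polynomial.derivative_neg,
      Polynomial.derivative_sum, Polynomial.derivative_C,
      Polynomial.derivative_X_pow, zero_mul, zero_add, Polynomial.eval_mul,
      Polynomial.eval_neg, Polynomial.eval_finsetSum, Polynomial.eval_C,
      Polynomial.eval_pow, Polynomial.eval_X, one_pow, mul_one, neg_mul, one_mul]
    congr 1
    refine Finset.sum_congr rfl fun j hj => ?_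
    rw [ctilde_eq hq0 hq hA (Nat.lt_succ_iff.1 (Finset.mem_range.1 hj)) (by omega)]
    simp
    ring
  have hq' : ∀ k : ℤ, k ≠ 0 → q⁻¹ ^ k ≠ 1 := by
    intro k hk
    rw [inv_zpow']
    exact hq _ (neg_ne_zero.2 hk)
  have h2 : q ^ (-((n : ℤ) * ((r : ℤ) - 1))) * (P0tilde A r n q⁻¹).eval 1
      = -∑ s ∈ Finset.Icc 1 A, ∑ j ∈ Finset.range (n + 1),
        (-1) ^ s * q ^ (-(j : ℤ)) * polarCoeff A r n s j q
          * ∑ k ∈ Finset.Icc 1 (n - j), q ^ (-(k : ℤ)) / (1 - q ^ (-(k : ℤ))) ^ s := by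
    rw [P0tilde_eval (inv_ne_zero hq0) hq' hA, mul_neg, Finset.mul_sum]
    congr 1
    refine Finset.sum_congr rfl fun s _ => ?_
    rw [Finset.mul_sum, ← Finset.sum_range_reflect]
    refine Finset.sum_congr rfl fun j hj => ?_
    have hj' : j ≤ n := Nat.lt_succ_iff.1 (Finset.mem_range.1 hj)
    rw [Nat.add_sub_cancel, polarCoeff_inv hq0 hA hr hAr, Nat.cast_sub hj', sub_sub_cancel]
    simp only [inv_zpow']
    have : q ^ (-((n : ℤ) * ((r : ℤ) - 1))) * q ^ (- -((n : ℤ) - j)) * q ^ ((r - 2) * n : ℤ)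
        = q ^ (-(j : ℤ)) := by
      rw [← zpow_add₀ hq0, ← zpow_add₀ hq0]
      congr 1
      ring
    rw [← this]
    ring
  rw [P0hat, h1, h2, P0tilde_eval hq0 hq hA, sub_neg_eq_add, sub_neg_eq_add]
  congr 1
  simp only [mul_sub, Finset.sum_sub_distrib]
  ring

end Symmetry

/-! ### Membership of P̂₀ in subrings, and its growth exponent. -/

section Subrings

variable {K : Type*} [Field K]

/-- The power series with coefficients in a subring. -/
def seriesSubring (S : Subring K) : Subring (PowerSeries K) :=
  (PowerSeries.map S.subtype).range

theorem coeff_mem_of_mem_seriesSubring {S : Subring K} {f : PowerSeries K}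
    (hf : f ∈ seriesSubring S) (n : ℕ) : PowerSeries.coeff n f ∈ S := by
  obtain ⟨F, rfl⟩ := hf
  rw [PowerSeries.coeff_map]
  exact (PowerSeries.coeff n F).2

theorem C_mem_seriesSubring {S : Subring K} {a : K} (ha : a ∈ S) :
    PowerSeries.C a ∈ seriesSubring S :=
  ⟨PowerSeries.C ⟨a, ha⟩, by simp⟩

theorem X_mem_seriesSubring (S : Subring K) : PowerSeries.X ∈ seriesSubring S :=
  ⟨PowerSeries.X, by simp⟩

theorem inv_mem_seriesSubring {S : Subring K} {f : PowerSeries K} (hf : f ∈ seriesSubring S)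
    (h0 : PowerSeries.constantCoeff f ≠ 0) (h : (PowerSeries.constantCoeff f)⁻¹ ∈ S) :
    f⁻¹ ∈ seriesSubring S := by
  obtain ⟨F, rfl⟩ := hf
  have hc : PowerSeries.constantCoeff (PowerSeries.map S.subtype F)
      = ((PowerSeries.constantCoeff F : S) : K) := by
    rw [← PowerSeries.coeff_zero_eq_constantCoeff_apply, PowerSeries.coeff_map,
      PowerSeries.coeff_zero_eq_constantCoeff_apply]
    rfl
  rw [hc] at h h0
  have hu : IsUnit (PowerSeries.constantCoeff F) :=
    IsUnit.of_mul_eq_one ⟨_, h⟩ (Subtype.ext (mul_inv_cancel₀ h0))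
  obtain ⟨G, hG⟩ := (PowerSeries.isUnit_iff_constantCoeff.2 hu).exists_left_inv
  refine ⟨G, ?_⟩
  rw [PowerSeries.eq_inv_iff_mul_eq_one (hc ▸ h0), ← map_mul, hG, map_one]

theorem prod_zpow_eq_zpow_sum {ι : Type*} {q : K} (hq0 : q ≠ 0) (s : Finset ι) (f : ι → ℤ) :
    ∏ i ∈ s, q ^ f i = q ^ ∑ i ∈ s, f i := by
  classical
  induction s using Finset.induction_on with
  | empty => simp
  | insert a s ha ih => rw [Finset.prod_insert ha, Finset.sum_insert ha, ih, zpow_add₀ hq0]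

/-- Serves twice: with functions of degree at most 0, for the growth, and with functions whose
denominators are products of q and cyclotomic polynomials, with e = 0. -/
theorem zpow_mul_P0hat_mem {q : K} (hq0 : q ≠ 0) (hq : ∀ k : ℤ, k ≠ 0 → q ^ k ≠ 1) {A r : ℕ}
    (hA : Even A) (hr : 1 ≤ r) (hAr : 2 * r < A) (n : ℕ) (S : Subring K) (e : ℤ)
    (hS : ∀ j : ℕ, q ^ (-(j : ℤ)) ∈ S)
    (hk : ∀ k : ℤ, k ≠ 0 → |k| ≤ n → ∀ s : ℕ, 1 ≤ s → q ^ k / (1 - q ^ k) ^ s ∈ S)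
    (hc : ∀ s j : ℕ, j ≤ n → q ^ e * polarCoeff A r n s j q ∈ S) :
    q ^ e * P0hat A r n q ∈ S := by
  rw [P0hat_eq hq0 hq hA hr hAr, mul_add, mul_neg, Finset.mul_sum, Finset.mul_sum]
  refine S.add_mem (S.neg_mem (S.sum_mem fun s hs => ?_)) (S.sum_mem fun j hj => ?_)
  · rw [Finset.mul_sum]
    refine S.sum_mem fun j hj => ?_
    have hj' : j ≤ n := Nat.lt_succ_iff.1 (Finset.mem_range.1 hj)
    have hs1 := (Finset.mem_Icc.1 hs).1
    rw [show ∀ a b c d x : K, x * (a * b * c * d) = a * b * (x * c) * d by intros; ring]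
    refine S.mul_mem (S.mul_mem (S.mul_mem (S.pow_mem (S.neg_mem S.one_mem) _) (hS j))
      (hc s j hj')) (S.sub_mem (S.sum_mem fun k hk' => ?_) (S.sum_mem fun k hk' => ?_))
    · have := Finset.mem_Icc.1 hk'
      exact hk k (by omega) (by rw [abs_le]; omega) s hs1
    · have := Finset.mem_Icc.1 hk'
      exact hk (-k) (by omega) (by rw [abs_le]; omega) s hs1
  · have hj' : j ≤ n := Nat.lt_succ_iff.1 (Finset.mem_range.1 hj)
    rw [show ∀ a b c x : K, x * (a * b * c) = a * b * (x * c) by intros; ring]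
    exact S.mul_mem (S.mul_mem (natCast_mem S j) (hS j)) (hc 1 j hj')

theorem polarCoeff_mem {q : K} (hq : ∀ k : ℤ, k ≠ 0 → q ^ k ≠ 1) (A r n s : ℕ) {j : ℕ}
    (hj : j ≤ n) (S : Subring K) (hS : ∀ k : ℤ, q ^ k ∈ S)
    (hk : ∀ k : ℤ, k ≠ 0 → |k| ≤ n → (1 - q ^ k)⁻¹ ∈ S) :
    polarCoeff A r n s j q ∈ S := by
  have hell : ∀ k : ℤ, ell q 1 k ∈ seriesSubring S := fun k => by
    rw [ell, map_one, one_mul]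
    exact sub_mem (one_mem _) (mul_mem (C_mem_seriesSubring (hS k))
      (add_mem (one_mem _) (X_mem_seriesSubring S)))
  refine coeff_mem_of_mem_seriesSubring ?_ _
  rw [localSeries]
  refine mul_mem (mul_mem (mul_mem (mul_mem (C_mem_seriesSubring (hS _)) (pow_mem ?_ _))
    (C_mem_seriesSubring (pow_mem ?_ _))) (prod_mem fun i _ => hell _))
    (pow_mem (inv_mem_seriesSubring (prod_mem fun i _ => hell _)
      (constantCoeff_prod_ell_ne_zero hq 1 n j) ?_) _)
  · rw [map_one, one_mul]
    exact add_mem (one_mem _) (X_mem_seriesSubring S)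
  · refine prod_mem fun i _ => sub_mem (one_mem _) (mul_mem ?_ (pow_mem ?_ _)) <;>
    simpa using hS 1
  · rw [map_prod, ← Finset.prod_inv_distrib]
    refine prod_mem fun i hi => ?_
    rw [constantCoeff_ell]
    simp only [poleSet, Finset.mem_erase, Finset.mem_Icc] at hi
    exact hk _ (by omega) (by rw [abs_le]; omega)

/-- The exponent of `q` governing the growth of `polarCoeff` as `q → ∞`. -/
def growthExp (A r n : ℕ) (j : ℤ) : ℤ :=
  -(j * topExp A r n) + (A - 2 * r : ℕ) * ∑ i ∈ Finset.range n, ((i : ℤ) + 1)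
    + ∑ i ∈ zeroSet r n, max (i - j) 0 - A * ∑ i ∈ poleSet n j, max (i - j) 0

/-- Each factor 1 - q^k(1+u) has growth q^max(k,0). Divided by it, the factor has coefficients in S,
and for k ≠ 0 its constant term is a unit of S, so that poles may be inverted. `growthExp` adds up
these exponents. -/
theorem zpow_growthExp_mul_polarCoeff_mem {q : K} (hq0 : q ≠ 0)
    (hq : ∀ k : ℤ, k ≠ 0 → q ^ k ≠ 1) (A r n s : ℕ) (j : ℤ) (S : Subring K) (hS : q⁻¹ ∈ S)
    (hk : ∀ k : ℕ, 1 ≤ k → (1 - q⁻¹ ^ k)⁻¹ ∈ S) :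
    q ^ (-growthExp A r n j) * polarCoeff A r n s j q ∈ S := by
  have hneg : ∀ k : ℤ, k ≤ 0 → q ^ k ∈ S := fun k hk => by
    obtain ⟨m, hm⟩ := Int.eq_ofNat_of_zero_le (neg_nonneg.2 hk)
    rw [show k = -(m : ℤ) by omega, zpow_neg, zpow_natCast, ← inv_pow]
    exact pow_mem hS m
  have hX : (1 : PowerSeries K) + PowerSeries.X ∈ seriesSubring S :=
    add_mem (one_mem _) (X_mem_seriesSubring S)
  have hell : ∀ k : ℤ, PowerSeries.C (q ^ (-max k 0)) * ell q 1 k ∈ seriesSubring S := fun k => by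
    have : PowerSeries.C (q ^ (-max k 0)) * ell q 1 k
        = PowerSeries.C (q ^ (-max k 0))
          - PowerSeries.C (q ^ (-max k 0 + k)) * (1 + PowerSeries.X) := by
      rw [ell, zpow_add₀ hq0, map_mul, map_one]
      ring
    rw [this]
    exact sub_mem (C_mem_seriesSubring (hneg _ (by omega)))
      (mul_mem (C_mem_seriesSubring (hneg _ (by omega))) hX)
  have hellc : ∀ k : ℤ, k ≠ 0 → (q ^ (-max k 0) * (1 - q ^ k))⁻¹ ∈ S := fun k hk0 => by
    rcases lt_or_gt_of_ne hk0 with h | h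
    · have := hk k.natAbs (by omega)
      rw [max_eq_right h.le, neg_zero, zpow_zero, one_mul]
      rwa [inv_pow, ← zpow_natCast, ← zpow_neg, show -(k.natAbs : ℤ) = k by omega] at this
    · have := hk k.natAbs (by omega)
      rw [max_eq_left h.le, mul_sub, mul_one, ← zpow_add₀ hq0, neg_add_cancel, zpow_zero,
        ← neg_sub, inv_neg]
      rw [inv_pow, ← zpow_natCast, ← zpow_neg, show -(k.natAbs : ℤ) = -k by omega] at this
      exact neg_mem this
  have hprod : ∀ s : Finset ℤ, PowerSeries.C (q ^ (-∑ i ∈ s, max (i - j) 0))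
      * ∏ i ∈ s, ell q 1 (i - j)
      = ∏ i ∈ s, (PowerSeries.C (q ^ (-max (i - j) 0)) * ell q 1 (i - j)) := fun s => by
    rw [Finset.prod_mul_distrib, ← map_prod, prod_zpow_eq_zpow_sum hq0, Finset.sum_neg_distrib]
  have hpoch : q ^ (-∑ i ∈ Finset.range n, ((i : ℤ) + 1)) * qPoch q q n ∈ S := by
    rw [← Finset.sum_neg_distrib, ← prod_zpow_eq_zpow_sum hq0, qPoch, ← Finset.prod_mul_distrib]
    refine prod_mem fun i _ => ?_
    rw [← pow_succ', ← zpow_natCast, mul_sub, ← zpow_add₀ hq0]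
    exact sub_mem (mul_mem (hneg _ (by omega)) (one_mem _)) (hneg _ (by push_cast; omega))
  set P := ∏ i ∈ poleSet n j, ell q 1 (i - j) with hP
  have hinv : PowerSeries.C (q ^ (∑ i ∈ poleSet n j, max (i - j) 0)) * P⁻¹
      ∈ seriesSubring S := by
    have h1 : PowerSeries.C (q ^ (∑ i ∈ poleSet n j, max (i - j) 0)) * P⁻¹
        = (PowerSeries.C (q ^ (-∑ i ∈ poleSet n j, max (i - j) 0)) * P)⁻¹ := by
      rw [PowerSeries.mul_inv_rev, PowerSeries.C_inv, ← zpow_neg, neg_neg, mul_comm]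
    rw [h1, hprod]
    refine inv_mem_seriesSubring (prod_mem fun i _ => hell _) ?_ ?_
    · rw [← hprod, map_mul, PowerSeries.constantCoeff_C]
      exact mul_ne_zero (zpow_ne_zero _ hq0) (constantCoeff_prod_ell_ne_zero hq 1 n j)
    · rw [map_prod, ← Finset.prod_inv_distrib]
      refine prod_mem fun i hi => ?_
      rw [map_mul, constantCoeff_ell, PowerSeries.constantCoeff_C]
      simp only [poleSet, Finset.mem_erase, Finset.mem_Icc] at hi
      exact hellc _ (by omega)
  have hq1 : q ^ (-growthExp A r n j) = q ^ (j * topExp A r n)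
      * (q ^ (-∑ i ∈ Finset.range n, ((i : ℤ) + 1))) ^ (A - 2 * r)
      * q ^ (-∑ i ∈ zeroSet r n, max (i - j) 0)
      * (q ^ (∑ i ∈ poleSet n j, max (i - j) 0)) ^ A := by
    rw [← zpow_natCast, ← zpow_mul, ← zpow_natCast (q ^ (∑ i ∈ poleSet n j, max (i - j) 0)),
      ← zpow_mul, ← zpow_add₀ hq0, ← zpow_add₀ hq0, ← zpow_add₀ hq0, growthExp]
    congr 1
    ring
  have hq2 : PowerSeries.C (q ^ (j * topExp A r n)) * PowerSeries.C (q ^ (-(j * topExp A r n)))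
      = (1 : PowerSeries K) := by
    rw [← map_mul, ← zpow_add₀ hq0]
    simp
  have hfin : PowerSeries.C (q ^ (-growthExp A r n j)) * localSeries A r n j q 1
      = (1 + PowerSeries.X) ^ topExp A r n
        * PowerSeries.C ((q ^ (-∑ i ∈ Finset.range n, ((i : ℤ) + 1)) * qPoch q q n) ^ (A - 2 * r))
        * (PowerSeries.C (q ^ (-∑ i ∈ zeroSet r n, max (i - j) 0))
          * ∏ i ∈ zeroSet r n, ell q 1 (i - j))
        * (PowerSeries.C (q ^ (∑ i ∈ poleSet n j, max (i - j) 0)) * P⁻¹) ^ A := by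
    rw [localSeries, ← hP, hq1]
    simp only [map_mul, map_pow, mul_pow, map_one, one_mul]
    linear_combination ((1 + PowerSeries.X) ^ topExp A r n
      * (PowerSeries.C (q ^ (-∑ i ∈ Finset.range n, ((i : ℤ) + 1))) ^ (A - 2 * r)
        * PowerSeries.C (qPoch q q n) ^ (A - 2 * r))
        * (PowerSeries.C (q ^ (-∑ i ∈ zeroSet r n, max (i - j) 0))
          * ∏ i ∈ zeroSet r n, ell q 1 (i - j))
        * (PowerSeries.C (q ^ (∑ i ∈ poleSet n j, max (i - j) 0)) ^ A * P⁻¹ ^ A)) * hq2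
  rw [polarCoeff, ← PowerSeries.coeff_C_mul, hfin]
  refine coeff_mem_of_mem_seriesSubring (mul_mem (mul_mem (mul_mem (pow_mem hX _)
    (C_mem_seriesSubring (pow_mem hpoch _))) ?_) (pow_mem hinv _)) _
  rw [hprod]
  exact prod_mem fun i _ => hell _

theorem sum_range_add (c : ℝ) (a : ℕ) :
    ∑ i ∈ Finset.range a, (c + i) = a * c + a * (a - 1) / 2 := by
  induction a with
  | zero => simp
  | succ a ih =>
    rw [Finset.sum_range_succ, ih]
    push_cast
    ring

theorem sum_zeroSet_max (r n : ℕ) {j : ℕ} (hj : j ≤ n) :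
    ((∑ i ∈ zeroSet r n, max (i - (j : ℤ)) 0 : ℤ) : ℝ)
      = r * n * (n + 1 - j) + r * n * (r * n - 1) / 2 := by
  have h := prod_zeroSet (fun i : ℤ => Multiplicative.ofAdd (max (i - (j : ℤ)) 0)) r n
  simp only [← ofAdd_sum, ← ofAdd_add] at h
  rw [Multiplicative.ofAdd.injective h, Finset.sum_eq_zero, zero_add]
  · have h2 := sum_range_add ((n : ℝ) + 1 - j) (r * n)
    push_cast at h2
    rw [← h2]
    push_cast
    refine Finset.sum_congr rfl fun i _ => ?_
    have hj' : (j : ℝ) ≤ n := by exact_mod_cast hj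
    have hi : (0 : ℝ) ≤ i := i.cast_nonneg
    rw [max_eq_left (by linarith)]
    ring
  · intro i hi
    have := Finset.mem_range.1 hi
    rw [max_eq_right]
    omega

theorem sum_poleSet_max (n : ℕ) {j : ℕ} (hj : j ≤ n) :
    ((∑ i ∈ poleSet n j, max (i - (j : ℤ)) 0 : ℤ) : ℝ) = (n - j) * (n - j + 1) / 2 := by
  have h := prod_poleSet (fun i : ℤ => Multiplicative.ofAdd (max (i - (j : ℤ)) 0)) n j
  simp only [← ofAdd_sum] at h
  rw [Multiplicative.ofAdd.injective h, Finset.sum_erase _ (by simp)]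
  obtain ⟨d, rfl⟩ := Nat.exists_eq_add_of_le hj
  rw [add_assoc, Finset.sum_range_add, Finset.sum_eq_zero, zero_add]
  · have h2 := sum_range_add 0 (d + 1)
    push_cast at h2 ⊢
    rw [show ((j : ℝ) + d - j) * (j + d - j + 1) / 2 = (d + 1) * 0 + (d + 1) * (d + 1 - 1) / 2
      by ring, ← h2]
    refine Finset.sum_congr rfl fun i _ => ?_
    have hi : (0 : ℝ) ≤ i := i.cast_nonneg
    rw [max_eq_left (by linarith)]
    ring
  · intro i hi
    have := Finset.mem_range.1 hi
    rw [max_eq_right]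
    omega

/-- With A = 2a the exponent equals a j(n-j) + r²n²/2 + 2j - rn/2. The square (n-2j)² bounds j(n-j)
by n²/4, and 2j ≤ 2n. -/
theorem growthExp_le {A r : ℕ} (hA : Even A) (hr : 1 ≤ r) (hAr : 2 * r < A) (n : ℕ) {j : ℕ}
    (hj : j ≤ n) :
    (growthExp A r n j : ℝ) ≤ ((A : ℝ) / 8 + (r : ℝ) ^ 2 / 2) * (n : ℝ) ^ 2 + 2 * n := by
  obtain ⟨a, rfl⟩ := hA.two_dvd
  have h1 : ((topExp (2 * a) r n : ℤ) : ℝ) = (a - r) * n + a - 2 := by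
    rw [topExp_eq n (by omega) (by omega)]
    push_cast
    rfl
  have h2 := sum_range_add 1 n
  have h3 : ((∑ i ∈ Finset.range n, ((i : ℤ) + 1) : ℤ) : ℝ) = n * 1 + n * (n - 1) / 2 := by
    rw [← h2]
    push_cast
    exact Finset.sum_congr rfl fun i _ => add_comm _ _
  have h4 : (((2 * a - 2 * r : ℕ) : ℤ) : ℝ) = 2 * a - 2 * r := by
    rw [Int.cast_natCast, Nat.cast_sub hAr.le]
    push_cast
    rfl
  have hj' : (j : ℝ) ≤ n := by exact_mod_cast hj
  have hj0 : (0 : ℝ) ≤ j := j.cast_nonneg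
  have ha : (0 : ℝ) ≤ a := a.cast_nonneg
  have hr0 : (0 : ℝ) ≤ r * n := by positivity
  rw [growthExp, Int.cast_sub, Int.cast_add, Int.cast_add, Int.cast_neg, Int.cast_mul,
    Int.cast_mul, Int.cast_mul, sum_zeroSet_max r n hj, sum_poleSet_max n hj, h1, h3, h4]
  push_cast
  nlinarith [mul_nonneg ha (sq_nonneg ((n : ℝ) - 2 * j))]

end Subrings

/-! ### Reduction at a root of unity, through the graph of a partial homomorphism. -/

section Reduction

variable {K L : Type*} [Field K] [Field L]

/-- `f` has coefficients in the domain of the partial homomorphism with graph `T`, and its image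
is `g`. -/
def SeriesReduces (T : Subring (K × L)) (f : PowerSeries K) (g : PowerSeries L) : Prop :=
  ∃ F : PowerSeries T, PowerSeries.map ((RingHom.fst K L).comp T.subtype) F = f ∧
    PowerSeries.map ((RingHom.snd K L).comp T.subtype) F = g

namespace SeriesReduces

variable {T : Subring (K × L)} {f f' : PowerSeries K} {g g' : PowerSeries L}

theorem coeff (h : SeriesReduces T f g) (n : ℕ) :
    (PowerSeries.coeff n f, PowerSeries.coeff n g) ∈ T := by
  obtain ⟨F, rfl, rfl⟩ := h
  exact (PowerSeries.coeff n F).2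

theorem C {x : K} {y : L} (h : (x, y) ∈ T) :
    SeriesReduces T (PowerSeries.C x) (PowerSeries.C y) :=
  ⟨PowerSeries.C ⟨_, h⟩, by simp, by simp⟩

theorem X : SeriesReduces T PowerSeries.X PowerSeries.X :=
  ⟨PowerSeries.X, by simp, by simp⟩

theorem one : SeriesReduces T 1 1 := ⟨1, by simp, by simp⟩

theorem mul (h : SeriesReduces T f g) (h' : SeriesReduces T f' g') :
    SeriesReduces T (f * f') (g * g') := by
  obtain ⟨F, rfl, rfl⟩ := h
  obtain ⟨F', rfl, rfl⟩ := h'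
  exact ⟨F * F', by simp, by simp⟩

theorem add (h : SeriesReduces T f g) (h' : SeriesReduces T f' g') :
    SeriesReduces T (f + f') (g + g') := by
  obtain ⟨F, rfl, rfl⟩ := h
  obtain ⟨F', rfl, rfl⟩ := h'
  exact ⟨F + F', by simp, by simp⟩

theorem sub (h : SeriesReduces T f g) (h' : SeriesReduces T f' g') :
    SeriesReduces T (f - f') (g - g') := by
  obtain ⟨F, rfl, rfl⟩ := h
  obtain ⟨F', rfl, rfl⟩ := h'
  exact ⟨F - F', by simp, by simp⟩

theorem pow (h : SeriesReduces T f g) (n : ℕ) : SeriesReduces T (f ^ n) (g ^ n) := by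
  obtain ⟨F, rfl, rfl⟩ := h
  exact ⟨F ^ n, by simp, by simp⟩

theorem prod {ι : Type*} (s : Finset ι) {f : ι → PowerSeries K} {g : ι → PowerSeries L}
    (h : ∀ i ∈ s, SeriesReduces T (f i) (g i)) :
    SeriesReduces T (∏ i ∈ s, f i) (∏ i ∈ s, g i) := by
  classical
  induction s using Finset.induction_on with
  | empty => simpa using one
  | insert a s ha ih =>
    rw [Finset.prod_insert ha, Finset.prod_insert ha]
    exact (h a (Finset.mem_insert_self a s)).mul
      (ih fun i hi => h i (Finset.mem_insert_of_mem hi))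

/-- The hypothesis `hT` says that T is local: a pair with nonzero reduction is a unit. A series
whose constant term has nonzero reduction is then invertible over T. -/
theorem inv (hT : ∀ x y, (x, y) ∈ T → y ≠ 0 → x ≠ 0 ∧ (x⁻¹, y⁻¹) ∈ T)
    (h : SeriesReduces T f g) (hg : PowerSeries.constantCoeff g ≠ 0) :
    SeriesReduces T f⁻¹ g⁻¹ := by
  have h0 := h.coeff 0
  simp only [PowerSeries.coeff_zero_eq_constantCoeff_apply] at h0
  obtain ⟨hf, hi⟩ := hT _ _ h0 hg
  obtain ⟨F, hF, hG⟩ := h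
  have hc : ((PowerSeries.constantCoeff F : T) : K × L)
      = (PowerSeries.constantCoeff f, PowerSeries.constantCoeff g) := by
    rw [← hF, ← hG]
    simp only [← PowerSeries.coeff_zero_eq_constantCoeff_apply, PowerSeries.coeff_map]
    rfl
  have hu : IsUnit (PowerSeries.constantCoeff F) := by
    refine IsUnit.of_mul_eq_one ⟨_, hi⟩ (Subtype.ext ?_)
    rw [Subring.coe_mul, hc]
    exact Prod.ext (mul_inv_cancel₀ hf) (mul_inv_cancel₀ hg)
  obtain ⟨G, hG'⟩ := (PowerSeries.isUnit_iff_constantCoeff.2 hu).exists_left_inv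
  refine ⟨G, ?_, ?_⟩
  · rw [PowerSeries.eq_inv_iff_mul_eq_one hf, ← hF, ← map_mul, hG', map_one]
  · rw [PowerSeries.eq_inv_iff_mul_eq_one hg, ← hG, ← map_mul, hG', map_one]

end SeriesReduces

section Scalars

variable {T : Subring (K × L)}

theorem pair_zpow_mem (hT : ∀ x y, (x, y) ∈ T → y ≠ 0 → x ≠ 0 ∧ (x⁻¹, y⁻¹) ∈ T) {x : K} {y : L}
    (h : (x, y) ∈ T) (hy : y ≠ 0) (k : ℤ) : (x ^ k, y ^ k) ∈ T := by
  obtain ⟨k, rfl | rfl⟩ := k.eq_nat_or_neg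
  · simpa using T.pow_mem h k
  · simpa using T.pow_mem (hT _ _ h hy).2 k

theorem pair_sum_mem {ι : Type*} (s : Finset ι) {f : ι → K} {g : ι → L}
    (h : ∀ i ∈ s, (f i, g i) ∈ T) : (∑ i ∈ s, f i, ∑ i ∈ s, g i) ∈ T := by
  have := T.sum_mem h
  rwa [show ∑ i ∈ s, (f i, g i) = (∑ i ∈ s, f i, ∑ i ∈ s, g i) from
    Prod.ext (Prod.fst_sum ..) (Prod.snd_sum ..)] at this

theorem pair_prod_mem {ι : Type*} (s : Finset ι) {f : ι → K} {g : ι → L}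
    (h : ∀ i ∈ s, (f i, g i) ∈ T) : (∏ i ∈ s, f i, ∏ i ∈ s, g i) ∈ T := by
  have := T.prod_mem h
  rwa [show ∏ i ∈ s, (f i, g i) = (∏ i ∈ s, f i, ∏ i ∈ s, g i) from
    Prod.ext (Prod.fst_prod ..) (Prod.snd_prod ..)] at this

variable {q : K} {ζ : L} {m : ℕ}

/-- For l ≥ 0 the quotient is the geometric sum of the q^(mi), i < l, and each term reduces to 1.
Negative l follows on multiplying by -q^(ml). -/
theorem pair_qInt_mem (hT : ∀ x y, (x, y) ∈ T → y ≠ 0 → x ≠ 0 ∧ (x⁻¹, y⁻¹) ∈ T)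
    (hqζ : (q, ζ) ∈ T) (hζ : IsPrimitiveRoot ζ m) (hm : 0 < m) (hqm : q ^ m ≠ 1) (l : ℤ) :
    ((1 - q ^ (m * l : ℤ)) / (1 - q ^ m), (l : L)) ∈ T := by
  have hζ0 : ζ ≠ 0 := hζ.ne_zero hm.ne'
  have hq0 : q ≠ 0 := (hT _ _ hqζ hζ0).1
  have hpos : ∀ l : ℕ, ((1 - q ^ (m * l : ℤ)) / (1 - q ^ m), (l : L)) ∈ T := fun l => by
    have h1 := pair_sum_mem (T := T) (Finset.range l) (f := fun i => (q ^ m) ^ i)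
      (g := fun i => (ζ ^ m) ^ i) fun i _ => T.pow_mem (T.pow_mem hqζ m) i
    rw [geom_sum_eq hqm, hζ.pow_eq_one] at h1
    rw [← neg_sub, ← neg_sub (q ^ m), neg_div_neg_eq, zpow_mul, zpow_natCast, zpow_natCast]
    simpa using h1
  obtain ⟨k, rfl | rfl⟩ := l.eq_nat_or_neg
  · simpa using hpos k
  · have h1 := T.neg_mem (T.mul_mem (pair_zpow_mem hT hqζ hζ0 (m * -(k : ℤ))) (hpos k))
    have h2 : ζ ^ (m * -(k : ℤ)) = 1 := by
      rw [zpow_mul, zpow_natCast, hζ.pow_eq_one, one_zpow]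
    rw [h2, Prod.mk_mul_mk, Prod.neg_mk, one_mul] at h1
    convert h1 using 2
    · rw [← mul_div_assoc, ← neg_div, mul_sub, ← zpow_add₀ hq0]
      simp
    · simp

theorem pair_one_sub_zpow_mem (hT : ∀ x y, (x, y) ∈ T → y ≠ 0 → x ≠ 0 ∧ (x⁻¹, y⁻¹) ∈ T)
    (hqζ : (q, ζ) ∈ T) (hζ0 : ζ ≠ 0) (k : ℤ) : (1 - q ^ k, 1 - ζ ^ k) ∈ T :=
  T.sub_mem T.one_mem (pair_zpow_mem hT hqζ hζ0 k)

theorem one_sub_zpow_ne_zero (hζ : IsPrimitiveRoot ζ m) {k : ℤ} (hk : ¬ (m : ℤ) ∣ k) :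
    1 - ζ ^ k ≠ 0 := by
  rw [sub_ne_zero]
  exact fun h => hk (hζ.zpow_eq_one_iff_dvd k |>.1 h.symm)

/-- The reduction of the linear factor `ell q τ k`, divided by `τ` if `m ∣ k`,
for `τ = 1 - q^m`. -/
def ellRed (m : ℕ) (ζ : L) (k : ℤ) : PowerSeries L :=
  if (m : ℤ) ∣ k then PowerSeries.C ((k / m : ℤ) : L) - PowerSeries.X
  else PowerSeries.C (1 - ζ ^ k)

theorem seriesReduces_ell (hT : ∀ x y, (x, y) ∈ T → y ≠ 0 → x ≠ 0 ∧ (x⁻¹, y⁻¹) ∈ T)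
    (hqζ : (q, ζ) ∈ T) (hζ : IsPrimitiveRoot ζ m) (hm : 0 < m) (hqm : q ^ m ≠ 1) (k : ℤ) :
    SeriesReduces T ((if (m : ℤ) ∣ k then PowerSeries.C (1 - q ^ m)⁻¹ else 1)
      * ell q (1 - q ^ m) k) (ellRed m ζ k) := by
  have hζ0 : ζ ≠ 0 := hζ.ne_zero hm.ne'
  have hπ : 1 - q ^ m ≠ 0 := sub_ne_zero.2 hqm.symm
  rw [ellRed]
  split_ifs with h
  · obtain ⟨l, rfl⟩ := h
    have hz := pair_zpow_mem hT hqζ hζ0 (m * l)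
    have h2 : ζ ^ (m * l : ℤ) = 1 := by
      rw [zpow_mul, zpow_natCast, hζ.pow_eq_one, one_zpow]
    rw [h2] at hz
    have h3 := (SeriesReduces.C (pair_qInt_mem hT hqζ hζ hm hqm l)).sub
      ((SeriesReduces.C hz).mul .X)
    rw [Int.mul_ediv_cancel_left _ (by omega)]
    convert h3 using 1
    · have hC : PowerSeries.C (1 - q ^ (m * l : ℤ)) = 1 - PowerSeries.C (q ^ (m * l : ℤ)) := by
        rw [map_sub, map_one]
      rw [ell, div_eq_mul_inv, map_mul PowerSeries.C (1 - q ^ (m * l : ℤ)), hC]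
      have : PowerSeries.C (1 - q ^ m)⁻¹ * PowerSeries.C (1 - q ^ m) = (1 : PowerSeries K) := by
        rw [← map_mul, inv_mul_cancel₀ hπ, map_one]
      linear_combination (-PowerSeries.C (q ^ (m * l : ℤ)) * PowerSeries.X) * this
    · simp
  · have hπ0 : (1 - q ^ m, (0 : L)) ∈ T := by
      have h1 : ((1 : K) - q ^ m, (1 : L) - ζ ^ m) ∈ T := T.sub_mem T.one_mem (T.pow_mem hqζ m)
      rwa [hζ.pow_eq_one, sub_self] at h1
    rw [one_mul, ell]
    have h3 := (SeriesReduces.one (T := T)).sub ((SeriesReduces.C (pair_zpow_mem hT hqζ hζ0 k)).mul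
      (SeriesReduces.one.add ((SeriesReduces.C hπ0).mul .X)))
    convert h3 using 1
    simp

theorem constantCoeff_ellRed_ne_zero [CharZero L] (hζ : IsPrimitiveRoot ζ m) {k : ℤ} (hk : k ≠ 0) :
    PowerSeries.constantCoeff (ellRed m ζ k) ≠ 0 := by
  rw [ellRed]
  split_ifs with h
  · obtain ⟨l, rfl⟩ := h
    have hm : (m : ℤ) ≠ 0 := left_ne_zero_of_mul hk
    rw [Int.mul_ediv_cancel_left _ hm]
    simpa using right_ne_zero_of_mul hk
  · simpa using one_sub_zpow_ne_zero hζ h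

end Scalars

/-! ### Zeros and poles in a residue class modulo m. -/

section Counting

/-- The elements of `s` congruent to `j` modulo `m`. -/
def congSet (m : ℕ) (s : Finset ℤ) (j : ℤ) : Finset ℤ := {i ∈ s | (m : ℤ) ∣ i - j}

theorem prod_ite_dvd_C (m : ℕ) (s : Finset ℤ) (j : ℤ) (x : K) :
    ∏ i ∈ s, (if (m : ℤ) ∣ i - j then PowerSeries.C x else 1)
      = PowerSeries.C (x ^ (congSet m s j).card) := by
  rw [← Finset.prod_filter, Finset.prod_const, map_pow, congSet]

theorem card_zeroSet (r n : ℕ) : (zeroSet r n).card = 2 * (r * n) := by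
  rw [zeroSet, Finset.card_union_of_disjoint]
  · simp only [Int.card_Ico]
    omega
  · rw [Finset.disjoint_left]
    intro x hx hy
    simp only [Finset.mem_Ico] at hx hy
    omega

theorem affine_injective {m : ℕ} (hm : 0 < m) (c : ℤ) :
    Function.Injective fun l : ℤ => c + m * l := by
  intro x y h
  have hm' : (m : ℤ) ≠ 0 := by omega
  exact mul_left_cancel₀ hm' (add_left_cancel h)

/-- For j₀ ≤ n₀ the class of j contains a scaled copy of the zeros belonging to ⌊n/m⌋. It may
contain more zeros; these only raise the order of vanishing. -/
theorem image_zeroSet_subset {m n r : ℕ} {j j₀ j₁ n₀ n₁ : ℤ} (hj : j = j₀ + m * j₁)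
    (hn : n = n₀ + m * n₁) (h0 : 0 ≤ j₀) (h1 : j₀ ≤ n₀) (h2 : n₀ < m) {N : ℕ} (hN : (N : ℤ) = n₁) :
    (zeroSet r N).image (fun l : ℤ => j₀ + m * l) ⊆ congSet m (zeroSet r n) j := by
  intro x hx
  obtain ⟨l, hl, rfl⟩ := Finset.mem_image.1 hx
  have hm : (0 : ℤ) ≤ m := by omega
  have hr : (0 : ℤ) ≤ r := by omega
  have hrn : (r : ℤ) * n = r * n₀ + m * (r * n₁) := by rw [hn]; ring
  have hrn0 : 0 ≤ (r : ℤ) * n₀ := mul_nonneg hr (h0.trans h1)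
  simp only [congSet, zeroSet, Finset.mem_filter, Finset.mem_union, Finset.mem_Ico] at hl ⊢
  push_cast at hl ⊢
  rw [hN] at hl
  refine ⟨?_, ⟨l - j₁, by rw [hj]; ring⟩⟩
  rcases hl with ⟨ha, hb⟩ | ⟨ha, hb⟩
  · left
    have h3 := mul_le_mul_of_nonneg_left ha hm
    have h4 := mul_le_mul_of_nonneg_left (show l ≤ -1 by omega) hm
    rw [mul_neg] at h3
    constructor <;> omega
  · right
    have h3 := mul_le_mul_of_nonneg_left ha hm
    have h4 := mul_le_mul_of_nonneg_left (show l ≤ n₁ + r * n₁ by omega) hm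
    rw [mul_add] at h3 h4
    constructor <;> omega

theorem congSet_poleSet {m n : ℕ} {j j₀ j₁ n₀ n₁ : ℤ} (hj : j = j₀ + m * j₁)
    (hn : n = n₀ + m * n₁) (h0 : 0 ≤ j₀) (h1 : j₀ ≤ n₀) (h2 : n₀ < m) {N : ℕ} (hN : (N : ℤ) = n₁) :
    congSet m (poleSet n j) j = (poleSet N j₁).image (fun l : ℤ => j₀ + m * l) := by
  have hm : (0 : ℤ) ≤ m := by omega
  have hm' : (m : ℤ) ≠ 0 := by omega
  ext x
  simp only [congSet, poleSet, Finset.mem_filter, Finset.mem_erase, Finset.mem_Icc,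
    Finset.mem_image]
  constructor
  · rintro ⟨⟨hne, hx0, hxn⟩, ⟨c, hc⟩⟩
    refine ⟨j₁ + c, ⟨?_, ?_, ?_⟩, by rw [mul_add]; omega⟩
    · intro h
      have : c = 0 := by omega
      rw [this, mul_zero] at hc
      omega
    · by_contra h
      have h4 := mul_le_mul_of_nonneg_left (show j₁ + c ≤ -1 by omega) hm
      rw [mul_add] at h4
      omega
    · by_contra h
      have h4 := mul_le_mul_of_nonneg_left (show n₁ + 1 ≤ j₁ + c by omega) hm
      rw [mul_add, mul_add] at h4
      omega
  · rintro ⟨l, ⟨hne, hl0, hln⟩, rfl⟩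
    rw [hN] at hln
    have h3 := mul_le_mul_of_nonneg_left hl0 hm
    have h4 := mul_le_mul_of_nonneg_left hln hm
    refine ⟨⟨?_, by omega, by omega⟩, ⟨l - j₁, by rw [hj]; ring⟩⟩
    rw [hj]
    intro h
    exact hne (mul_left_cancel₀ hm' (add_left_cancel h))

theorem card_congSet_zeroSet_ge {m n r : ℕ} (hm : 0 < m) (j : ℕ) :
    2 * (r * (n / m)) ≤ (congSet m (zeroSet r n) j).card := by
  have hj : (j : ℤ) = (j % m : ℕ) + m * (j / m : ℕ) := by exact_mod_cast (Nat.mod_add_div j m).symm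
  have hn : (n : ℤ) = (n % m : ℕ) + m * (n / m : ℕ) := by exact_mod_cast (Nat.mod_add_div n m).symm
  have hj0 := Nat.mod_lt j hm
  have hn0 := Nat.mod_lt n hm
  by_cases h : j % m ≤ n % m
  · have := Finset.card_le_card (image_zeroSet_subset (r := r) (N := n / m) hj hn (by omega)
      (by omega) (by omega) rfl)
    rwa [Finset.card_image_of_injective _ (affine_injective hm _), card_zeroSet] at this
  · generalize n / m = n₁ at *
    generalize j / m = j₁ at *
    generalize j % m = j₀ at *
    generalize n % m = n₀ at *
    have hmz : (0 : ℤ) ≤ m := by omega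
    have hrn : (r : ℤ) * n = r * n₀ + m * (r * n₁) := by rw [hn]; ring
    have hrn0 : 0 ≤ (r : ℤ) * n₀ := by positivity
    -- The upper interval starts at n₁ instead of n₁ + 1, since j₀ > n₀ already makes j₀ + m n₁
    -- exceed n.
    have hsub : (Finset.Ico (-((r * n₁ : ℕ) : ℤ)) 0 ∪ Finset.Ico (n₁ : ℤ) (n₁ + (r * n₁ : ℕ))).image
        (fun l : ℤ => (j₀ : ℤ) + m * l) ⊆ congSet m (zeroSet r n) j := by
      intro x hx
      obtain ⟨l, hl, rfl⟩ := Finset.mem_image.1 hx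
      simp only [congSet, zeroSet, Finset.mem_filter, Finset.mem_union, Finset.mem_Ico] at hl ⊢
      push_cast at hl ⊢
      refine ⟨?_, ⟨l - j₁, by rw [hj]; ring⟩⟩
      rcases hl with ⟨ha, hb⟩ | ⟨ha, hb⟩
      · left
        have h3 := mul_le_mul_of_nonneg_left ha hmz
        have h4 := mul_le_mul_of_nonneg_left (show l ≤ -1 by omega) hmz
        rw [mul_neg] at h3
        constructor <;> omega
      · right
        have h3 := mul_le_mul_of_nonneg_left ha hmz
        have h4 := mul_le_mul_of_nonneg_left (show l + 1 ≤ n₁ + r * n₁ by omega) hmz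
        rw [mul_add, mul_add] at h4
        constructor <;> omega
    have hc := Finset.card_le_card hsub
    rw [Finset.card_image_of_injective _ (affine_injective hm _),
      Finset.card_union_of_disjoint] at hc
    · simp only [Int.card_Ico] at hc
      omega
    · rw [Finset.disjoint_left]
      intro x hx hy
      simp only [Finset.mem_Ico] at hx hy
      omega

theorem card_congSet_poleSet {m n j : ℕ} (hm : 0 < m) (hj : j ≤ n) (h : j % m ≤ n % m) :
    (congSet m (poleSet n j) j).card = n / m := by
  have hj' : (j : ℤ) = (j % m : ℕ) + m * (j / m : ℕ) := by
    exact_mod_cast (Nat.mod_add_div j m).symm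
  have hn : (n : ℤ) = (n % m : ℕ) + m * (n / m : ℕ) := by exact_mod_cast (Nat.mod_add_div n m).symm
  have hn0 := Nat.mod_lt n hm
  have := Nat.div_le_div_right (c := m) hj
  generalize n / m = n₁ at *
  generalize j / m = j₁ at *
  generalize j % m = j₀ at *
  generalize n % m = n₀ at *
  rw [congSet_poleSet (N := n₁) hj' hn (by omega) (by omega) (by omega) rfl,
    Finset.card_image_of_injective _ (affine_injective hm _), poleSet,
    Finset.card_erase_of_mem, Int.card_Icc]
  · omega
  · rw [Finset.mem_Icc]
    omega

/-- Such a class meets [0, n] in only ⌊n/m⌋ points, one of which is j. The missing pole is what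
forces the reduction to vanish. -/
theorem card_congSet_poleSet_lt {m n j : ℕ} (hm : 0 < m) (hj : j ≤ n) (h : n % m < j % m) :
    (congSet m (poleSet n j) j).card + 1 ≤ n / m := by
  have hj' : (j : ℤ) = (j % m : ℕ) + m * (j / m : ℕ) := by
    exact_mod_cast (Nat.mod_add_div j m).symm
  have hn : (n : ℤ) = (n % m : ℕ) + m * (n / m : ℕ) := by exact_mod_cast (Nat.mod_add_div n m).symm
  have hj0 := Nat.mod_lt j hm
  generalize n / m = n₁ at *
  generalize j / m = j₁ at *
  generalize j % m = j₀ at *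
  generalize n % m = n₀ at *
  have hmz : (0 : ℤ) ≤ m := by omega
  have hlt : (j₁ : ℤ) < n₁ := by
    by_contra h'
    have h4 := mul_le_mul_of_nonneg_left (not_lt.1 h') hmz
    omega
  have hsub : congSet m (poleSet n j) j
      ⊆ ((Finset.Ico 0 (n₁ : ℤ)).erase j₁).image (fun l : ℤ => (j₀ : ℤ) + m * l) := by
    intro x
    simp only [congSet, poleSet, Finset.mem_filter, Finset.mem_erase, Finset.mem_Icc,
      Finset.mem_image, Finset.mem_Ico]
    rintro ⟨⟨hne, hx0, hxn⟩, ⟨c, hc⟩⟩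
    refine ⟨j₁ + c, ⟨?_, ?_, ?_⟩, by rw [mul_add]; omega⟩
    · intro h
      have : c = 0 := by omega
      rw [this, mul_zero] at hc
      omega
    · by_contra h
      have h4 := mul_le_mul_of_nonneg_left (show j₁ + c ≤ -1 by omega) hmz
      rw [mul_add] at h4
      omega
    · by_contra h
      have h4 := mul_le_mul_of_nonneg_left (show (n₁ : ℤ) ≤ j₁ + c by omega) hmz
      rw [mul_add] at h4
      omega
  have hc := Finset.card_le_card hsub
  rw [Finset.card_image_of_injective _ (affine_injective hm _), Finset.card_erase_of_mem,
    Int.card_Ico] at hc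
  · omega
  · rw [Finset.mem_Ico]
    omega

end Counting

end Reduction

/-! ### The reduced local series and its reflection symmetry. -/

section LeadingTerm

variable {K L : Type*} [Field K] [Field L]

/-- The reduction of the linear factors at exponents congruent to that of the pole. -/
def linRed (L : Type*) [Field L] (k : ℤ) : PowerSeries L := PowerSeries.C (k : L) - PowerSeries.X

theorem rescale_linRed (k : ℤ) :
    PowerSeries.rescale (-1 : L) (linRed L k) = -linRed L (-k) := by
  rw [linRed, linRed, map_sub, rescale_C, PowerSeries.rescale_X]
  simp [add_comm]

theorem prod_ellRed (m : ℕ) (ζ : L) (s : Finset ℤ) (j : ℤ) :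
    ∏ i ∈ s, ellRed m ζ (i - j) = (∏ i ∈ congSet m s j, linRed L ((i - j) / m))
      * PowerSeries.C (∏ i ∈ s with ¬ (m : ℤ) ∣ i - j, (1 - ζ ^ (i - j))) := by
  simp only [ellRed]
  rw [Finset.prod_ite, map_prod]
  rfl

/-- Away from the class of j the reduced factors depend on j only modulo m. Two index sets are
allowed because the pole sets for j and its reflection differ, though only inside that class. -/
theorem prod_not_dvd_congr {m : ℕ} {ζ : L} (hζ : IsPrimitiveRoot ζ m) (hm : 0 < m)
    {s s' : Finset ℤ} {j j' : ℤ} (hjj : (m : ℤ) ∣ j - j')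
    (hs : ∀ i, ¬ (m : ℤ) ∣ i - j → (i ∈ s ↔ i ∈ s')) :
    (∏ i ∈ s with ¬ (m : ℤ) ∣ i - j, (1 - ζ ^ (i - j)))
      = ∏ i ∈ s' with ¬ (m : ℤ) ∣ i - j', (1 - ζ ^ (i - j')) := by
  have hd : ∀ i, (m : ℤ) ∣ i - j ↔ (m : ℤ) ∣ i - j' := fun i => by
    rw [show i - j' = (i - j) + (j - j') by ring]
    exact (dvd_add_left hjj).symm
  refine Finset.prod_congr ?_ fun i _ => ?_
  · ext i
    simp only [Finset.mem_filter, ← hd]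
    exact ⟨fun h => ⟨(hs i h.2).1 h.1, h.2⟩, fun h => ⟨(hs i h.2).2 h.1, h.2⟩⟩
  · rw [show i - j' = (i - j) + (j - j') by ring, zpow_add₀ (hζ.ne_zero hm.ne'),
      (hζ.zpow_eq_one_iff_dvd _).2 hjj, mul_one]

theorem prod_image_affine {m : ℕ} (hm : 0 < m) {j j₀ j₁ : ℤ} (hj : j = j₀ + m * j₁)
    (s : Finset ℤ) :
    ∏ i ∈ s.image (fun l : ℤ => j₀ + m * l), linRed L ((i - j) / m)
      = ∏ l ∈ s, linRed L (l - j₁) := by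
  rw [Finset.prod_image (affine_injective hm j₀).injOn]
  refine Finset.prod_congr rfl fun l _ => ?_
  rw [hj, show j₀ + m * l - (j₀ + m * j₁) = m * (l - j₁) by ring,
    Int.mul_ediv_cancel_left _ (by omega)]

/-- The reflection `j₀ + m j₁ ↦ j₀ + m (⌊n/m⌋ - j₁)`, where `0 ≤ j₀ < m`. -/
def reflectMod (m n j : ℕ) : ℕ := j % m + m * (n / m - j / m)

theorem reflectMod_mod {m : ℕ} (n j : ℕ) : reflectMod m n j % m = j % m := by
  simp [reflectMod]

theorem reflectMod_div {m : ℕ} (hm : 0 < m) (n j : ℕ) :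
    reflectMod m n j / m = n / m - j / m := by
  rw [reflectMod, Nat.add_mul_div_left _ _ hm, Nat.div_eq_of_lt (Nat.mod_lt j hm), zero_add]

theorem reflectMod_le {m n j : ℕ} (h : j % m ≤ n % m) : reflectMod m n j ≤ n := by
  have h1 : m * (n / m - j / m) ≤ m * (n / m) := Nat.mul_le_mul_left _ (Nat.sub_le _ _)
  have h2 := Nat.mod_add_div n m
  rw [reflectMod]
  omega

theorem reflectMod_reflectMod {m n j : ℕ} (hm : 0 < m) (hj : j ≤ n) :
    reflectMod m n (reflectMod m n j) = j := by
  have h1 := Nat.div_le_div_right (c := m) hj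
  rw [reflectMod, reflectMod_mod, reflectMod_div hm, Nat.sub_sub_self h1, Nat.mod_add_div]

theorem sub_div_eq {m n j : ℕ} (hm : 0 < m) (hj : j ≤ n) (h : j % m ≤ n % m) :
    (n - j) / m = n / m - j / m := by
  have h1 := Nat.mod_add_div n m
  have h2 := Nat.mod_add_div j m
  have h3 : n - j = (n % m - j % m) + m * (n / m - j / m) := by
    have h4 := Nat.mul_le_mul_left m (Nat.div_le_div_right (c := m) hj)
    rw [Nat.mul_sub]
    omega
  rw [h3, Nat.add_mul_div_left _ _ hm,
    Nat.div_eq_of_lt (lt_of_le_of_lt (Nat.sub_le _ _) (Nat.mod_lt n hm)), zero_add]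

/-- The order of vanishing, at a primitive `m`-th root of unity, of the leading coefficient at the
pole `q^(-j)`. -/
def vanishingOrder (A r m n j : ℕ) : ℕ :=
  n / m * (A - 2 * r) + (congSet m (zeroSet r n) j).card - A * (congSet m (poleSet n j) j).card

/-- Ensures that the subtraction in `vanishingOrder` does not truncate: the factors 1 - q^m from
(q)_n and from the zeros outweigh those from the poles. -/
theorem mul_card_congSet_poleSet_le {A r m n j : ℕ} (hAr : 2 * r < A) (hm : 0 < m) (hj : j ≤ n) :
    A * (congSet m (poleSet n j) j).card
      ≤ n / m * (A - 2 * r) + (congSet m (zeroSet r n) j).card := by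
  have h1 := card_congSet_zeroSet_ge (n := n) (r := r) hm j
  have h2 : (congSet m (poleSet n j) j).card ≤ n / m := by
    rcases le_or_gt (j % m) (n % m) with h | h
    · exact (card_congSet_poleSet hm hj h).le
    · have := card_congSet_poleSet_lt hm hj h
      omega
  calc _ ≤ A * (n / m) := Nat.mul_le_mul_left _ h2
    _ = n / m * (A - 2 * r) + 2 * (r * (n / m)) := by
      rw [mul_comm, ← mul_assoc, mul_comm (2 * r), ← mul_add, Nat.sub_add_cancel hAr.le]
    _ ≤ _ := Nat.add_le_add_left h1 _

theorem vanishingOrder_pos {A r m n j : ℕ} (hAr : 2 * r < A) (hm : 0 < m) (hj : j ≤ n)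
    (h : n % m < j % m) : vanishingOrder A r m n j ≠ 0 := by
  have h1 := card_congSet_zeroSet_ge (n := n) (r := r) hm j
  have h2 := card_congSet_poleSet_lt hm hj h
  have h3 : A * (congSet m (poleSet n j) j).card + A
      ≤ n / m * (A - 2 * r) + (congSet m (zeroSet r n) j).card :=
    calc _ = A * ((congSet m (poleSet n j) j).card + 1) := by ring
      _ ≤ A * (n / m) := Nat.mul_le_mul_left _ h2
      _ = n / m * (A - 2 * r) + 2 * (r * (n / m)) := by
        rw [mul_comm, ← mul_assoc, mul_comm (2 * r), ← mul_add, Nat.sub_add_cancel hAr.le]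
      _ ≤ _ := Nat.add_le_add_left h1 _
  rw [vanishingOrder]
  omega

theorem vanishingOrder_eq {A r m n j : ℕ} (hAr : 2 * r < A) (hm : 0 < m) (hj : j ≤ n)
    (h : j % m ≤ n % m) :
    vanishingOrder A r m n j = (congSet m (zeroSet r n) j).card - 2 * (r * (n / m)) := by
  have h3 : A * (n / m) = n / m * (A - 2 * r) + 2 * (r * (n / m)) := by
    rw [mul_comm, ← mul_assoc, mul_comm (2 * r), ← mul_add, Nat.sub_add_cancel hAr.le]
  rw [vanishingOrder, card_congSet_poleSet hm hj h, h3]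
  omega

theorem congSet_congr {m : ℕ} (s : Finset ℤ) {j j' : ℤ} (h : (m : ℤ) ∣ j - j') :
    congSet m s j = congSet m s j' := by
  refine Finset.filter_congr fun i _ => ?_
  rw [show i - j' = (i - j) + (j - j') by ring]
  exact (dvd_add_left h).symm

/-- The reduction of the part of `localSeries` prime to `1 - q^m`. -/
def redSeries (A r m n : ℕ) (ζ κ : L) (j : ℤ) : PowerSeries L :=
  PowerSeries.C (ζ ^ (-(j * topExp A r n))) * PowerSeries.C (κ ^ (A - 2 * r))
    * (∏ i ∈ zeroSet r n, ellRed m ζ (i - j)) * (∏ i ∈ poleSet n j, ellRed m ζ (i - j))⁻¹ ^ A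

theorem constantCoeff_prod_ellRed_ne_zero [CharZero L] {m : ℕ} {ζ : L} (hζ : IsPrimitiveRoot ζ m)
    (n : ℕ) (j : ℤ) :
    PowerSeries.constantCoeff (∏ i ∈ poleSet n j, ellRed m ζ (i - j)) ≠ 0 := by
  rw [map_prod, Finset.prod_ne_zero_iff]
  intro i hi
  simp only [poleSet, Finset.mem_erase] at hi
  exact constantCoeff_ellRed_ne_zero hζ (by omega)

theorem rescale_prod_linRed_reflect (s : Finset ℤ) (f : ℤ → ℤ) :
    PowerSeries.rescale (-1 : L) (∏ l ∈ s, linRed L (f l))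
      = (-1) ^ s.card * ∏ l ∈ s, linRed L (-f l) := by
  rw [map_prod]
  simp only [rescale_linRed]
  rw [Finset.prod_neg]

/-- Vanishing order 0 leaves no surplus zeros, so zeros and poles in the class are those of the q =
1 problem for ⌊n/m⌋. There w ↦ -w turns l - w into -(-l - w), and l ↦ ⌊n/m⌋ - l permutes the zeros
and moves the pole to its reflection. -/
theorem rescale_redSeries [CharZero L] {A r m n j : ℕ} {ζ : L} (hζ : IsPrimitiveRoot ζ m)
    (hm : 0 < m) (κ : L) (hA : Even A) (hAr : 2 * r < A) (hj : j ≤ n) (h : j % m ≤ n % m)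
    (hv : vanishingOrder A r m n j = 0) :
    PowerSeries.rescale (-1 : L) (redSeries A r m n ζ κ j)
      = redSeries A r m n ζ κ (reflectMod m n j) := by
  set j' := reflectMod m n j with hj'
  have hj'n : j' ≤ n := reflectMod_le h
  have hd := Nat.div_le_div_right (c := m) hj
  have hjd : (j : ℤ) = (j % m : ℕ) + m * (j / m : ℕ) := by
    exact_mod_cast (Nat.mod_add_div j m).symm
  have hnd : (n : ℤ) = (n % m : ℕ) + m * (n / m : ℕ) := by
    exact_mod_cast (Nat.mod_add_div n m).symm
  have hjd' : (j' : ℤ) = (j % m : ℕ) + m * ((n / m : ℕ) - (j / m : ℕ)) := by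
    rw [hj', reflectMod]
    push_cast [Nat.cast_sub hd]
    rfl
  have hjj : (m : ℤ) ∣ (j : ℤ) - j' := ⟨(j / m : ℕ) - ((n / m : ℕ) - (j / m : ℕ)), by
    rw [hjd', hjd]; ring⟩
  have hn0 := Nat.mod_lt n hm
  have hcard : (congSet m (zeroSet r n) j).card = 2 * (r * (n / m)) := by
    have h1 := card_congSet_zeroSet_ge (n := n) (r := r) hm j
    rw [vanishingOrder_eq hAr hm hj h] at hv
    omega
  have hzero : congSet m (zeroSet r n) j
      = (zeroSet r (n / m)).image (fun l : ℤ => ((j % m : ℕ) : ℤ) + m * l) := by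
    symm
    refine Finset.eq_of_subset_of_card_le (image_zeroSet_subset hjd hnd (by omega) (by omega)
      (by omega) rfl) ?_
    rw [hcard, Finset.card_image_of_injective _ (affine_injective hm _), card_zeroSet]
  have hzero' := hzero
  rw [congSet_congr _ hjj] at hzero'
  have hpole := congSet_poleSet hjd hnd (by omega) (by omega) (by omega) rfl
  have hpole' := congSet_poleSet hjd' hnd (by omega) (by omega) (by omega) rfl
  have hz : PowerSeries.rescale (-1 : L) (∏ i ∈ zeroSet r n, ellRed m ζ (i - j))
      = ∏ i ∈ zeroSet r n, ellRed m ζ (i - j') := by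
    rw [prod_ellRed, prod_ellRed, hzero, hzero', prod_image_affine hm hjd,
      prod_image_affine hm hjd', map_mul, rescale_C, rescale_prod_linRed_reflect, card_zeroSet,
      pow_mul, neg_one_sq, one_pow, one_mul, prod_not_dvd_congr hζ hm hjj fun _ _ => Iff.rfl,
      ← prod_zeroSet_reflect]
    congr 1
    refine Finset.prod_congr rfl fun l _ => ?_
    congr 1
    ring
  -- The poles contribute a sign, harmless because the product enters with the even exponent A.
  have hp : ∃ c : L, c ^ A = 1 ∧ PowerSeries.rescale (-1 : L)
      (∏ i ∈ poleSet n j, ellRed m ζ (i - j))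
        = PowerSeries.C c * ∏ i ∈ poleSet n j', ellRed m ζ (i - j') := by
    refine ⟨(-1) ^ (poleSet (n / m) (j / m : ℕ)).card, ?_, ?_⟩
    · rw [← pow_mul, mul_comm, pow_mul, hA.neg_one_pow, one_pow]
    · rw [prod_ellRed, prod_ellRed, hpole, hpole', prod_image_affine hm hjd,
        prod_image_affine hm hjd', map_mul, rescale_C, rescale_prod_linRed_reflect,
        prod_not_dvd_congr hζ hm hjj (s' := poleSet n j'), ← prod_poleSet_reflect, map_pow,
        map_neg, map_one, mul_assoc]
      · congr 2
        refine Finset.prod_congr rfl fun l _ => ?_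
        congr 1
        ring
      · intro i hi
        have hi' : ¬ (m : ℤ) ∣ i - j' := fun h' => hi <| by
          rw [show i - j = (i - j') - ((j : ℤ) - j') by ring]
          exact dvd_sub h' hjj
        simp only [poleSet, Finset.mem_erase, Finset.mem_Icc]
        have h1 : i ≠ j := fun h' => hi (by simp [h'])
        have h2 : i ≠ j' := fun h' => hi' (by simp [h'])
        simp [h1, h2]
  obtain ⟨c, hc, hp⟩ := hp
  have hζj : ζ ^ (-((j : ℤ) * topExp A r n)) = ζ ^ (-((j' : ℤ) * topExp A r n)) := by
    rw [show -((j : ℤ) * topExp A r n)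
      = -((j' : ℤ) * topExp A r n) + (-(topExp A r n)) * ((j : ℤ) - j') by ring,
      zpow_add₀ (hζ.ne_zero hm.ne'),
      (hζ.zpow_eq_one_iff_dvd (-(topExp A r n : ℤ) * ((j : ℤ) - j'))).2 (hjj.mul_left _), mul_one]
  rw [redSeries, map_mul, map_mul, map_mul, map_pow (PowerSeries.rescale _) _ A, rescale_C, rescale_C, hz,
    rescale_inv _ (constantCoeff_prod_ellRed_ne_zero hζ n j), hp, PowerSeries.mul_inv_rev,
    mul_pow, PowerSeries.C_inv, ← map_pow PowerSeries.C c⁻¹, inv_pow, hc, inv_one, map_one,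
    mul_one, redSeries, hζj]

variable {T : Subring (K × L)} {q : K} {ζ : L} {m : ℕ}

theorem pair_pow_mem {x : K} {y : L} (h : (x, y) ∈ T) (k : ℕ) : (x ^ k, y ^ k) ∈ T :=
  T.pow_mem h k

/-- Exactly ⌊n/m⌋ factors of (q)_n vanish at ζ. The value κ is left unspecified, since it is
independent of j and plays no part in the symmetry. -/
theorem pair_qPoch_mem (hT : ∀ x y, (x, y) ∈ T → y ≠ 0 → x ≠ 0 ∧ (x⁻¹, y⁻¹) ∈ T)
    (hqζ : (q, ζ) ∈ T) (hζ : IsPrimitiveRoot ζ m) (hm : 0 < m) (hqm : q ^ m ≠ 1) (n : ℕ) :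
    ∃ κ : L, ((1 - q ^ m)⁻¹ ^ (n / m) * qPoch q q n, κ) ∈ T := by
  have h : ∀ i : ℕ, ∃ y : L, ((if m ∣ i + 1 then (1 - q ^ m)⁻¹ else 1) * (1 - q * q ^ i), y) ∈ T := by
    intro i
    rw [← pow_succ']
    split_ifs with hd
    · obtain ⟨l, hl⟩ := hd
      have := pair_qInt_mem hT hqζ hζ hm hqm l
      rw [div_eq_inv_mul] at this
      rw [hl]
      exact ⟨_, by exact_mod_cast this⟩
    · rw [one_mul]
      exact ⟨_, T.sub_mem T.one_mem (T.pow_mem hqζ (i + 1))⟩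
  choose y hy using h
  refine ⟨∏ i ∈ Finset.range n, y i, ?_⟩
  have := pair_prod_mem (Finset.range n) fun i _ => hy i
  rwa [Finset.prod_mul_distrib, ← Finset.prod_filter, Finset.prod_const,
    Nat.card_multiples n m] at this

theorem seriesReduces_localSeries [CharZero L]
    (hT : ∀ x y, (x, y) ∈ T → y ≠ 0 → x ≠ 0 ∧ (x⁻¹, y⁻¹) ∈ T)
    (hqζ : (q, ζ) ∈ T) (hζ : IsPrimitiveRoot ζ m) (hm : 0 < m) (hqm : q ^ m ≠ 1) {κ : L} {n : ℕ}
    (hκ : ((1 - q ^ m)⁻¹ ^ (n / m) * qPoch q q n, κ) ∈ T) {A r j : ℕ} (hAr : 2 * r < A)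
    (hj : j ≤ n) :
    SeriesReduces T (localSeries A r n j q (1 - q ^ m))
      (PowerSeries.C (0 ^ vanishingOrder A r m n j) * redSeries A r m n ζ κ j) := by
  have hζ0 : ζ ≠ 0 := hζ.ne_zero hm.ne'
  have hπ : 1 - q ^ m ≠ 0 := sub_ne_zero.2 hqm.symm
  have hπ0 : (1 - q ^ m, (0 : L)) ∈ T := by
    have h1 : ((1 : K) - q ^ m, (1 : L) - ζ ^ m) ∈ T := T.sub_mem T.one_mem (T.pow_mem hqζ m)
    rwa [hζ.pow_eq_one, sub_self] at h1
  have hprod : ∀ s : Finset ℤ, SeriesReduces T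
      (PowerSeries.C ((1 - q ^ m)⁻¹ ^ (congSet m s j).card) * ∏ i ∈ s, ell q (1 - q ^ m) (i - j))
      (∏ i ∈ s, ellRed m ζ (i - j)) := fun s => by
    have := SeriesReduces.prod s (T := T) fun i _ =>
      seriesReduces_ell hT hqζ hζ hm hqm (i - j)
    rwa [Finset.prod_mul_distrib, prod_ite_dvd_C] at this
  have hone : SeriesReduces T (1 + PowerSeries.C (1 - q ^ m) * PowerSeries.X) 1 := by
    simpa using (SeriesReduces.one (T := T)).add ((SeriesReduces.C hπ0).mul .X)
  have hmain := (SeriesReduces.C (pair_pow_mem hπ0 (vanishingOrder A r m n j))).mul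
    (((((SeriesReduces.C (pair_zpow_mem hT hqζ hζ0 (-(j * topExp A r n)))).mul
      (hone.pow (topExp A r n))).mul (SeriesReduces.C (pair_pow_mem hκ (A - 2 * r)))).mul
      (hprod (zeroSet r n))).mul (((hprod (poleSet n j)).inv hT
        (constantCoeff_prod_ellRed_ne_zero hζ n j)).pow A))
  convert hmain using 1
  · rw [localSeries, PowerSeries.mul_inv_rev, PowerSeries.C_inv, ← inv_pow, inv_inv]
    generalize 1 - q ^ m = π at *
    -- The bookkeeping of the powers of π = 1 - q^m that were divided out of the factors.
    have hpow : π ^ vanishingOrder A r m n j * (π⁻¹ ^ (n / m)) ^ (A - 2 * r)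
        * π⁻¹ ^ (congSet m (zeroSet r n) j).card
        * (π ^ (congSet m (poleSet n j) j).card) ^ A = 1 := by
      have h1 := mul_card_congSet_poleSet_le hAr hm hj
      have h2 : vanishingOrder A r m n j + (congSet m (poleSet n j) j).card * A
          = n / m * (A - 2 * r) + (congSet m (zeroSet r n) j).card := by
        rw [vanishingOrder, mul_comm _ A]
        omega
      rw [← pow_mul, ← pow_mul, mul_assoc (π ^ _), ← pow_add, mul_right_comm, ← pow_add, h2,
        ← mul_pow, mul_inv_cancel₀ hπ, one_pow]
    have hpow' := congrArg (PowerSeries.C (R := K)) hpow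
    simp only [map_mul, map_pow, map_one] at hpow' ⊢
    simp only [mul_pow]
    linear_combination (-(PowerSeries.C (q ^ (-((j : ℤ) * topExp A r n)))
      * (1 + PowerSeries.C π * PowerSeries.X) ^ topExp A r n
      * PowerSeries.C (qPoch q q n) ^ (A - 2 * r)
      * (∏ i ∈ zeroSet r n, ell q π (i - j))
      * (∏ i ∈ poleSet n j, ell q π (i - j))⁻¹ ^ A)) * hpow'
  · rw [redSeries]
    simp

end LeadingTerm

/-! ### Cancellation of the order A part at a root of unity. -/

section Cancellation

variable {K L : Type*} [Field K] [Field L] {T : Subring (K × L)} {q : K} {ζ : L} {m : ℕ}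

theorem pair_one_sub_pow_mem (hqζ : (q, ζ) ∈ T) (hζ : IsPrimitiveRoot ζ m) :
    (1 - q ^ m, (0 : L)) ∈ T := by
  have h1 : ((1 : K) - q ^ m, (1 : L) - ζ ^ m) ∈ T := T.sub_mem T.one_mem (T.pow_mem hqζ m)
  rwa [hζ.pow_eq_one, sub_self] at h1

theorem pair_kernel_mem_of_dvd [CharZero L]
    (hT : ∀ x y, (x, y) ∈ T → y ≠ 0 → x ≠ 0 ∧ (x⁻¹, y⁻¹) ∈ T)
    (hqζ : (q, ζ) ∈ T) (hζ : IsPrimitiveRoot ζ m) (hm : 0 < m) (hqm : q ^ m ≠ 1) (s : ℕ) {l : ℤ}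
    (hl : l ≠ 0) :
    ((1 - q ^ m) ^ s * (q ^ (m * l : ℤ) / (1 - q ^ (m * l : ℤ)) ^ s), (l : L)⁻¹ ^ s) ∈ T := by
  have h1 := (hT _ _ (pair_qInt_mem hT hqζ hζ hm hqm l) (by exact_mod_cast hl)).2
  have h2 := pair_zpow_mem hT hqζ (hζ.ne_zero hm.ne') (m * l)
  rw [zpow_mul ζ, zpow_natCast, hζ.pow_eq_one, one_zpow] at h2
  have h3 := T.mul_mem h2 (pair_pow_mem h1 s)
  rw [Prod.mk_mul_mk, one_mul] at h3
  convert h3 using 2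
  rw [inv_div, div_pow]
  ring

theorem pair_kernel_mem_of_not_dvd
    (hT : ∀ x y, (x, y) ∈ T → y ≠ 0 → x ≠ 0 ∧ (x⁻¹, y⁻¹) ∈ T)
    (hqζ : (q, ζ) ∈ T) (hζ : IsPrimitiveRoot ζ m) (hm : 0 < m) {s : ℕ} (hs : 1 ≤ s) {k : ℤ}
    (hk : ¬ (m : ℤ) ∣ k) :
    ((1 - q ^ m) ^ s * (q ^ k / (1 - q ^ k) ^ s), (0 : L)) ∈ T := by
  have hζ0 := hζ.ne_zero hm.ne'
  have h1 := (hT _ _ (pair_one_sub_zpow_mem hT hqζ hζ0 k) (one_sub_zpow_ne_zero hζ hk)).2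
  have h3 := T.mul_mem (T.mul_mem (pair_pow_mem (pair_one_sub_pow_mem hqζ hζ) s)
    (pair_zpow_mem hT hqζ hζ0 k)) (pair_pow_mem h1 s)
  rw [Prod.mk_mul_mk, Prod.mk_mul_mk, zero_pow (by omega), zero_mul, zero_mul] at h3
  convert h3 using 2
  rw [inv_pow]
  ring

theorem sum_Icc_ite_dvd (hm : 0 < m) (f : ℕ → L) (N : ℕ) :
    ∑ k ∈ Finset.Icc 1 N, (if m ∣ k then f (k / m) else 0) = ∑ l ∈ Finset.Icc 1 (N / m), f l := by
  rw [← Finset.sum_filter]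
  symm
  refine Finset.sum_nbij' (fun l => m * l) (fun k => k / m) ?_ ?_ ?_ ?_ ?_
  · intro l hl
    rw [Finset.mem_Icc] at hl
    rw [Finset.mem_filter, Finset.mem_Icc]
    refine ⟨⟨Nat.mul_pos hm hl.1, ?_⟩, dvd_mul_right m l⟩
    rw [mul_comm]
    exact (Nat.le_div_iff_mul_le hm).1 hl.2
  · intro k hk
    rw [Finset.mem_filter, Finset.mem_Icc] at hk
    rw [Finset.mem_Icc]
    exact ⟨Nat.div_pos (Nat.le_of_dvd hk.1.1 hk.2) hm, Nat.div_le_div_right hk.1.2⟩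
  · intro l _
    exact Nat.mul_div_cancel_left l hm
  · intro k hk
    exact Nat.mul_div_cancel' (Finset.mem_filter.1 hk).2
  · intro l _
    rw [Nat.mul_div_cancel_left l hm]

/-- The generalised harmonic number `∑_{l ≤ N} l^(-s)`. -/
def harmonicSum (L : Type*) [Field L] (s N : ℕ) : L := ∑ l ∈ Finset.Icc 1 N, (l : L)⁻¹ ^ s

theorem pair_sum_kernel_mem [CharZero L]
    (hT : ∀ x y, (x, y) ∈ T → y ≠ 0 → x ≠ 0 ∧ (x⁻¹, y⁻¹) ∈ T)
    (hqζ : (q, ζ) ∈ T) (hζ : IsPrimitiveRoot ζ m) (hm : 0 < m) (hqm : q ^ m ≠ 1) {s : ℕ}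
    (hs : 1 ≤ s) (N : ℕ) :
    ((1 - q ^ m) ^ s * ∑ k ∈ Finset.Icc 1 N, q ^ (k : ℤ) / (1 - q ^ (k : ℤ)) ^ s,
      harmonicSum L s (N / m)) ∈ T := by
  rw [harmonicSum, ← sum_Icc_ite_dvd hm, Finset.mul_sum]
  refine pair_sum_mem _ fun k hk => ?_
  have hk1 := (Finset.mem_Icc.1 hk).1
  split_ifs with hd
  · obtain ⟨l, rfl⟩ := hd
    have := pair_kernel_mem_of_dvd hT hqζ hζ hm hqm s (l := l)
      (by have := Nat.pos_of_mul_pos_left hk1; omega)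
    rw [Nat.mul_div_cancel_left l hm]
    simpa using this
  · exact pair_kernel_mem_of_not_dvd hT hqζ hζ hm hs (by rwa [Int.natCast_dvd_natCast])

theorem pair_sum_kernel_neg_mem [CharZero L]
    (hT : ∀ x y, (x, y) ∈ T → y ≠ 0 → x ≠ 0 ∧ (x⁻¹, y⁻¹) ∈ T)
    (hqζ : (q, ζ) ∈ T) (hζ : IsPrimitiveRoot ζ m) (hm : 0 < m) (hqm : q ^ m ≠ 1) {s : ℕ}
    (hs : 1 ≤ s) (N : ℕ) :
    ((1 - q ^ m) ^ s * ∑ k ∈ Finset.Icc 1 N, q ^ (-(k : ℤ)) / (1 - q ^ (-(k : ℤ))) ^ s,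
      (-1) ^ s * harmonicSum L s (N / m)) ∈ T := by
  rw [harmonicSum, Finset.mul_sum, Finset.mul_sum,
    ← sum_Icc_ite_dvd hm (fun l => (-1) ^ s * (l : L)⁻¹ ^ s)]
  refine pair_sum_mem _ fun k hk => ?_
  have hk1 := (Finset.mem_Icc.1 hk).1
  split_ifs with hd
  · obtain ⟨l, rfl⟩ := hd
    have := pair_kernel_mem_of_dvd hT hqζ hζ hm hqm s (l := -l)
      (by have := Nat.pos_of_mul_pos_left hk1; omega)
    rw [Nat.mul_div_cancel_left l hm, ← mul_pow, neg_one_mul, ← inv_neg]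
    simpa using this
  · exact pair_kernel_mem_of_not_dvd hT hqζ hζ hm hs
      (by rwa [dvd_neg, Int.natCast_dvd_natCast])

/-- The reductions are coefficients of 0^v times the reduced series, where v is the vanishing order
and 0^0 = 1. The parity sign is (-1)^(A-s) = (-1)^s. -/
theorem exists_reduced_polarCoeff [CharZero L]
    (hT : ∀ x y, (x, y) ∈ T → y ≠ 0 → x ≠ 0 ∧ (x⁻¹, y⁻¹) ∈ T)
    (hqζ : (q, ζ) ∈ T) (hζ : IsPrimitiveRoot ζ m) (hm : 0 < m)
    (hq : ∀ k : ℤ, k ≠ 0 → q ^ k ≠ 1) {A r : ℕ} (hA : Even A) (hAr : 2 * r < A) (n : ℕ) :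
    ∃ c : ℕ → ℕ → L,
      (∀ s j, j ≤ n → ((1 - q ^ m) ^ (A - s) * polarCoeff A r n s j q, c s j) ∈ T) ∧
      (∀ s j, j ≤ n → n % m < j % m → c s j = 0) ∧
      (∀ s j, s ≤ A → j ≤ n → j % m ≤ n % m → c s (reflectMod m n j) = (-1) ^ s * c s j) := by
  have hqm : q ^ m ≠ 1 := by simpa using hq m (by omega)
  obtain ⟨κ, hκ⟩ := pair_qPoch_mem hT hqζ hζ hm hqm n
  refine ⟨fun s j => PowerSeries.coeff (A - s)
    (PowerSeries.C (0 ^ vanishingOrder A r m n j) * redSeries A r m n ζ κ j), ?_, ?_, ?_⟩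
  · intro s j hj
    rw [← coeff_localSeries hq]
    exact (seriesReduces_localSeries hT hqζ hζ hm hqm hκ hAr hj).coeff _
  · intro s j hj h
    simp [zero_pow (vanishingOrder_pos hAr hm hj h)]
  · intro s j hs hj h
    have hr := reflectMod_mod (m := m) n j
    have hv : vanishingOrder A r m n (reflectMod m n j) = vanishingOrder A r m n j := by
      rw [vanishingOrder_eq hAr hm hj h, vanishingOrder_eq hAr hm (reflectMod_le h) (hr ▸ h),
        congSet_congr]
      exact (Nat.modEq_iff_dvd (n := m)).1 hr.symm
    -- The vanishing order depends only on the residue of j here, so when it is positive both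
    -- coefficients are 0.
    rcases eq_or_ne (vanishingOrder A r m n j) 0 with h0 | h0
    · simp only [hv, h0, pow_zero, map_one, one_mul]
      rw [← rescale_redSeries hζ hm κ hA hAr hj h h0, PowerSeries.coeff_rescale]
      congr 1
      obtain ⟨d, rfl⟩ := Nat.exists_eq_add_of_le hs
      rw [Nat.add_sub_cancel_left]
      have h1 := hA.neg_one_pow (α := L)
      rw [pow_add] at h1
      have h2 : ((-1 : L) ^ s) * (-1) ^ s = 1 := by rw [← mul_pow]; simp
      linear_combination (-1) ^ s * h1 - (-1) ^ d * h2
    · simp [hv, zero_pow h0]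

/-- Splitting (1-q^m)^A as (1-q^m)^(A-s) on the polar coefficient and (1-q^m)^s on the kernels makes
every term regular at ζ. The reflection matches H_s(⌊j/m⌋) with (-1)^s H_s(⌊(n-j)/m⌋). The
derivative term needs only the power A-1 and so reduces to 0. -/
theorem pair_pow_mul_P0hat_mem [CharZero L]
    (hT : ∀ x y, (x, y) ∈ T → y ≠ 0 → x ≠ 0 ∧ (x⁻¹, y⁻¹) ∈ T)
    (hqζ : (q, ζ) ∈ T) (hζ : IsPrimitiveRoot ζ m) (hm : 0 < m)
    (hq : ∀ k : ℤ, k ≠ 0 → q ^ k ≠ 1) {A r : ℕ} (hA : Even A) (hr : 1 ≤ r) (hAr : 2 * r < A)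
    (n : ℕ) : ((1 - q ^ m) ^ A * P0hat A r n q, (0 : L)) ∈ T := by
  have hqm : q ^ m ≠ 1 := by simpa using hq m (by omega)
  have hζ0 := hζ.ne_zero hm.ne'
  have hq0 : q ≠ 0 := (hT _ _ hqζ hζ0).1
  obtain ⟨c, hc, hc0, hcr⟩ := exists_reduced_polarCoeff hT hqζ hζ hm hq hA hAr n
  have hmain : ((1 - q ^ m) ^ A * ∑ s ∈ Finset.Icc 1 A, ∑ j ∈ Finset.range (n + 1),
        (-1) ^ s * q ^ (-(j : ℤ)) * polarCoeff A r n s j q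
          * (∑ k ∈ Finset.Icc 1 j, q ^ (k : ℤ) / (1 - q ^ (k : ℤ)) ^ s
            - ∑ k ∈ Finset.Icc 1 (n - j), q ^ (-(k : ℤ)) / (1 - q ^ (-(k : ℤ))) ^ s),
      ∑ s ∈ Finset.Icc 1 A, ∑ j ∈ Finset.range (n + 1), (-1) ^ s * ζ ^ (-(j : ℤ)) * c s j
        * (harmonicSum L s (j / m) - (-1) ^ s * harmonicSum L s ((n - j) / m))) ∈ T := by
    rw [Finset.mul_sum]
    refine pair_sum_mem _ fun s hs => ?_
    rw [Finset.mul_sum]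
    refine pair_sum_mem _ fun j hj => ?_
    have hj' : j ≤ n := Nat.lt_succ_iff.1 (Finset.mem_range.1 hj)
    obtain ⟨hs1, hsA⟩ := Finset.mem_Icc.1 hs
    have h1 : ((-1 : K) ^ s, (-1 : L) ^ s) ∈ T := T.pow_mem (T.neg_mem T.one_mem) s
    have h2 := T.mul_mem (T.mul_mem (T.mul_mem h1 (pair_zpow_mem hT hqζ hζ0 (-(j : ℤ))))
      (hc s j hj')) (T.sub_mem (pair_sum_kernel_mem hT hqζ hζ hm hqm hs1 j)
        (pair_sum_kernel_neg_mem hT hqζ hζ hm hqm hs1 (n - j)))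
    simp only [Prod.mk_mul_mk, Prod.mk_sub_mk] at h2
    convert h2 using 2
    obtain ⟨d, hd⟩ := Nat.exists_eq_add_of_le hsA
    rw [show A - s = d by omega, hd, pow_add]
    ring
  have hzero : ∑ s ∈ Finset.Icc 1 A, ∑ j ∈ Finset.range (n + 1), (-1) ^ s * ζ ^ (-(j : ℤ)) * c s j
        * (harmonicSum L s (j / m) - (-1) ^ s * harmonicSum L s ((n - j) / m)) = 0 := by
    refine Finset.sum_eq_zero fun s hs => ?_
    have hsA := (Finset.mem_Icc.1 hs).2
    have hs2 : ((-1 : L) ^ s) * (-1) ^ s = 1 := by rw [← mul_pow]; simp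
    -- Only residues at most n mod m contribute, and on these the reflection is an involution.
    rw [← Finset.sum_filter_of_ne (p := fun j => j % m ≤ n % m)]
    · simp only [mul_sub, Finset.sum_sub_distrib]
      rw [sub_eq_zero]
      have hmem : ∀ j ∈ {j ∈ Finset.range (n + 1) | j % m ≤ n % m}, j ≤ n ∧ j % m ≤ n % m := by
        intro j hj
        rw [Finset.mem_filter, Finset.mem_range] at hj
        omega
      have hrefl : ∀ j ∈ {j ∈ Finset.range (n + 1) | j % m ≤ n % m},
          reflectMod m n j ∈ {j ∈ Finset.range (n + 1) | j % m ≤ n % m} := by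
        intro j hj
        have := reflectMod_le (hmem j hj).2
        rw [Finset.mem_filter, Finset.mem_range, reflectMod_mod]
        exact ⟨by omega, (hmem j hj).2⟩
      refine Finset.sum_nbij' (reflectMod m n) (reflectMod m n) hrefl hrefl
        (fun j hj => reflectMod_reflectMod hm (hmem j hj).1)
        (fun j hj => reflectMod_reflectMod hm (hmem j hj).1) ?_
      intro j hj
      obtain ⟨hjn, hjm⟩ := hmem j hj
      have hζj : ζ ^ (-(reflectMod m n j : ℤ)) = ζ ^ (-(j : ℤ)) := by
        obtain ⟨d, hd⟩ := (Nat.modEq_iff_dvd (n := m)).1 (reflectMod_mod (m := m) n j)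
        rw [show -(reflectMod m n j : ℤ) = -(j : ℤ) + m * d by omega, zpow_add₀ hζ0, zpow_mul ζ m,
          zpow_natCast, hζ.pow_eq_one, one_zpow, mul_one]
      have hdj := Nat.div_le_div_right (c := m) hjn
      rw [hcr s j hsA hjn hjm, hζj, sub_div_eq hm (reflectMod_le hjm)
        ((reflectMod_mod n j).le.trans hjm), reflectMod_div hm, Nat.sub_sub_self hdj]
      linear_combination (-(-1) ^ s * ζ ^ (-(j : ℤ)) * c s j * harmonicSum L s (j / m)) * hs2
    · intro j hj hne
      by_contra h
      refine hne ?_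
      rw [hc0 s j (Nat.lt_succ_iff.1 (Finset.mem_range.1 hj)) (not_le.1 h)]
      ring
  have hder : ((1 - q ^ m) ^ A * ∑ j ∈ Finset.range (n + 1),
      (j : K) * q ^ (-(j : ℤ)) * polarCoeff A r n 1 j q, (0 : L)) ∈ T := by
    rw [Finset.mul_sum, ← Finset.sum_const_zero (s := Finset.range (n + 1))]
    refine pair_sum_mem _ fun j hj => ?_
    have hj' : j ≤ n := Nat.lt_succ_iff.1 (Finset.mem_range.1 hj)
    have h1 : ((j : K), (j : L)) ∈ T := natCast_mem T j
    have h2 := T.mul_mem (T.mul_mem (T.mul_mem h1 (pair_zpow_mem hT hqζ hζ0 (-(j : ℤ))))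
      (hc 1 j hj')) (pair_one_sub_pow_mem hqζ hζ)
    simp only [Prod.mk_mul_mk, mul_zero] at h2
    convert h2 using 2
    obtain ⟨d, hd⟩ := Nat.exists_eq_add_of_le (show 1 ≤ A by omega)
    rw [show A - 1 = d by omega, hd, pow_add]
    ring
  rw [hzero] at hmain
  have h := T.add_mem (T.neg_mem hmain) hder
  rw [Prod.neg_mk, Prod.mk_add_mk, neg_zero, add_zero] at h
  rw [P0hat_eq hq0 hq hA hr hAr, mul_add, mul_neg]
  exact h

end Cancellation

/-! ### Degree in q, and a criterion for membership in ℤ[1/q]. -/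

section Laurent

/-- Evaluation of an integer polynomial at the indeterminate of `RatFunc ℚ`. -/
def evX : Polynomial ℤ →+* RatFunc ℚ := (Polynomial.aeval (RatFunc.X : RatFunc ℚ)).toRingHom

theorem evX_X : evX Polynomial.X = RatFunc.X := by simp [evX]

theorem evX_apply (p : Polynomial ℤ) :
    evX p = algebraMap (Polynomial ℚ) (RatFunc ℚ) (p.map (Int.castRingHom ℚ)) := by
  have : evX = (algebraMap (Polynomial ℚ) (RatFunc ℚ)).comp
      (Polynomial.mapRingHom (Int.castRingHom ℚ)) := by
    refine Polynomial.ringHom_ext' (RingHom.ext_int _ _) ?_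
    simp [evX_X]
  rw [this]
  rfl

theorem evX_injective : Function.Injective evX := by
  intro p p' h
  rw [evX_apply, evX_apply] at h
  exact Polynomial.map_injective _ (RingHom.injective_int _) (RatFunc.algebraMap_injective ℚ h)

theorem X_zpow_ne_one (k : ℤ) (hk : k ≠ 0) : (RatFunc.X : RatFunc ℚ) ^ k ≠ 1 := by
  have hnat : ∀ k : ℕ, k ≠ 0 → (RatFunc.X : RatFunc ℚ) ^ k ≠ 1 := by
    intro k hk h
    rw [← evX_X, ← map_pow, ← map_one evX] at h
    have := congrArg Polynomial.natDegree (evX_injective h)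
    simp at this
    exact hk this
  obtain ⟨k, rfl | rfl⟩ := k.eq_nat_or_neg
  · rw [zpow_natCast]
    exact hnat k (by omega)
  · rw [zpow_neg, zpow_natCast, Ne, inv_eq_one]
    exact hnat k (by omega)

/-- The rational functions of non-positive degree. -/
def degSubring : Subring (RatFunc ℚ) where
  carrier := {x | x = 0 ∨ x.intDegree ≤ 0}
  zero_mem' := Or.inl rfl
  one_mem' := Or.inr (by simp)
  neg_mem' := by
    rintro x (rfl | h)
    · simp
    · exact Or.inr (by rwa [RatFunc.intDegree_neg])
  mul_mem' := by
    intro x y hx hy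
    rcases eq_or_ne x 0 with rfl | hx0
    · simp
    rcases eq_or_ne y 0 with rfl | hy0
    · simp
    have h1 := hx.resolve_left hx0
    have h2 := hy.resolve_left hy0
    exact Or.inr (by rw [RatFunc.intDegree_mul hx0 hy0]; omega)
  add_mem' := by
    intro x y hx hy
    rcases eq_or_ne x 0 with rfl | hx0
    · simpa using hy
    rcases eq_or_ne y 0 with rfl | hy0
    · simpa using hx
    rcases eq_or_ne (x + y) 0 with h0 | h0
    · exact Or.inl h0
    have h1 := hx.resolve_left hx0
    have h2 := hy.resolve_left hy0
    exact Or.inr ((RatFunc.intDegree_add_le hy0 h0).trans (max_le h1 h2))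

theorem mem_degSubring {x : RatFunc ℚ} : x ∈ degSubring ↔ x = 0 ∨ x.intDegree ≤ 0 := Iff.rfl

theorem intDegree_X_pow (k : ℕ) : ((RatFunc.X : RatFunc ℚ) ^ k).intDegree = k := by
  rw [← evX_X, ← map_pow, evX_apply, RatFunc.intDegree_polynomial]
  simp

theorem intDegree_evX (p : Polynomial ℤ) : (evX p).intDegree = p.natDegree := by
  rw [evX_apply, RatFunc.intDegree_polynomial,
    Polynomial.natDegree_map_eq_of_injective (RingHom.injective_int _)]

theorem intDegree_X_zpow (k : ℤ) : ((RatFunc.X : RatFunc ℚ) ^ k).intDegree = k := by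
  obtain ⟨k, rfl | rfl⟩ := k.eq_nat_or_neg
  · rw [zpow_natCast, intDegree_X_pow]
  · rw [zpow_neg, zpow_natCast, RatFunc.intDegree_inv, intDegree_X_pow]

theorem X_inv_mem_degSubring : (RatFunc.X : RatFunc ℚ)⁻¹ ∈ degSubring :=
  Or.inr (by rw [RatFunc.intDegree_inv, RatFunc.intDegree_X]; omega)

theorem X_zpow_mem_degSubring {k : ℤ} (hk : k ≤ 0) : (RatFunc.X : RatFunc ℚ) ^ k ∈ degSubring :=
  Or.inr (by rwa [intDegree_X_zpow])

theorem one_sub_X_inv_pow_inv_mem_degSubring (k : ℕ) (hk : 1 ≤ k) :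
    (1 - (RatFunc.X : RatFunc ℚ)⁻¹ ^ k)⁻¹ ∈ degSubring := by
  have hX : (RatFunc.X : RatFunc ℚ) ^ k ≠ 0 := pow_ne_zero _ RatFunc.X_ne_zero
  have h1 : (RatFunc.X : RatFunc ℚ) ^ k - 1 ≠ 0 := by
    rw [sub_ne_zero]
    exact_mod_cast X_zpow_ne_one k (by omega)
  have h2 : (1 - (RatFunc.X : RatFunc ℚ)⁻¹ ^ k)⁻¹
      = RatFunc.X ^ k * ((RatFunc.X : RatFunc ℚ) ^ k - 1)⁻¹ := by
    rw [inv_pow]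
    field_simp
  have h3 : (RatFunc.X : RatFunc ℚ) ^ k - 1 = evX (Polynomial.X ^ k - Polynomial.C 1) := by
    simp [evX_X]
  refine Or.inr ?_
  rw [h2, RatFunc.intDegree_mul hX (inv_ne_zero h1), RatFunc.intDegree_inv, intDegree_X_pow, h3,
    intDegree_evX, Polynomial.natDegree_X_pow_sub_C]
  omega

/-- The degree is k for k < 0 and k - ks for k > 0; the latter is where s ≥ 1 is needed. -/
theorem kernel_mem_degSubring {k : ℤ} (hk : k ≠ 0) {s : ℕ} (hs : 1 ≤ s) :
    (RatFunc.X : RatFunc ℚ) ^ k / (1 - RatFunc.X ^ k) ^ s ∈ degSubring := by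
  have hX0 : (RatFunc.X : RatFunc ℚ) ≠ 0 := RatFunc.X_ne_zero
  have h1 := one_sub_X_inv_pow_inv_mem_degSubring k.natAbs (by omega)
  rw [inv_pow, ← zpow_natCast, ← zpow_neg] at h1
  rcases lt_or_gt_of_ne hk with h | h
  · rw [show -(k.natAbs : ℤ) = k by omega] at h1
    rw [div_eq_mul_inv, ← inv_pow]
    exact mul_mem (X_zpow_mem_degSubring h.le) (pow_mem h1 s)
  · rw [show -(k.natAbs : ℤ) = -k by omega] at h1
    obtain ⟨d, rfl⟩ := Nat.exists_eq_add_of_le' hs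
    have h2 : (1 - (RatFunc.X : RatFunc ℚ) ^ k)
        = RatFunc.X ^ k * -(1 - (RatFunc.X : RatFunc ℚ) ^ (-k)) := by
      rw [mul_neg, mul_sub, ← zpow_add₀ hX0]
      simp
    have h3 : (RatFunc.X : RatFunc ℚ) ^ k / (1 - RatFunc.X ^ k) ^ (d + 1)
        = (RatFunc.X ^ (-k)) ^ d * (-(1 - (RatFunc.X : RatFunc ℚ) ^ (-k))⁻¹) ^ (d + 1) := by
      have h4 : (RatFunc.X : RatFunc ℚ) ^ k ≠ 0 := zpow_ne_zero _ hX0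
      rw [h2, mul_pow, ← inv_neg, inv_pow, pow_succ (RatFunc.X ^ k) d, zpow_neg, inv_pow,
        ← zpow_neg]
      field_simp
    rw [h3]
    exact mul_mem (pow_mem (X_zpow_mem_degSubring (by omega)) d) (pow_mem (neg_mem h1) _)

theorem zpow_mul_P0hat_mem_degSubring {A r : ℕ} (hA : Even A) (hr : 1 ≤ r) (hAr : 2 * r < A)
    (n : ℕ) {e : ℤ} (he : ∀ j : ℕ, j ≤ n → e + growthExp A r n j ≤ 0) :
    (RatFunc.X : RatFunc ℚ) ^ e * P0hat A r n RatFunc.X ∈ degSubring := by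
  have hX0 : (RatFunc.X : RatFunc ℚ) ≠ 0 := RatFunc.X_ne_zero
  refine zpow_mul_P0hat_mem hX0 X_zpow_ne_one hA hr hAr n _ e
    (fun j => X_zpow_mem_degSubring (by omega)) (fun k hk _ s hs => kernel_mem_degSubring hk hs)
    fun s j hj => ?_
  have h := mul_mem (X_zpow_mem_degSubring (he j hj))
    (zpow_growthExp_mul_polarCoeff_mem hX0 X_zpow_ne_one A r n s j degSubring
      X_inv_mem_degSubring one_sub_X_inv_pow_inv_mem_degSubring)
  rwa [← mul_assoc, ← zpow_add₀ hX0, add_neg_cancel_right] at h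

theorem X_zpow_mem_adjoin {k : ℤ} (hk : k ≤ 0) :
    (RatFunc.X : RatFunc ℚ) ^ k ∈ Algebra.adjoin ℤ {(RatFunc.X : RatFunc ℚ)⁻¹} := by
  obtain ⟨d, hd⟩ := Int.eq_ofNat_of_zero_le (show 0 ≤ -k by omega)
  rw [show k = -(d : ℤ) by omega, zpow_neg, zpow_natCast, ← inv_pow]
  exact Subalgebra.pow_mem _ (Algebra.self_mem_adjoin_singleton ℤ _) d

theorem intCast_mem_adjoin (c : ℤ) :
    (c : RatFunc ℚ) ∈ Algebra.adjoin ℤ {(RatFunc.X : RatFunc ℚ)⁻¹} := by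
  rw [← eq_intCast (algebraMap ℤ (RatFunc ℚ))]
  exact Subalgebra.algebraMap_mem _ c

theorem evX_eq_sum (H : Polynomial ℤ) : evX H
    = ∑ i ∈ Finset.range (H.natDegree + 1), (H.coeff i : RatFunc ℚ) * RatFunc.X ^ i :=
  (Polynomial.aeval_eq_sum_range _).trans (by simp only [Algebra.smul_def, eq_intCast])

/-- The degree bound applies to the top monomial of an integral Laurent polynomial, so every
monomial has exponent at most 0. -/
theorem mem_adjoin_X_inv {x : RatFunc ℚ} {a : ℕ} {H : Polynomial ℤ}
    (hx : x * RatFunc.X ^ a = evX H) {e : ℤ} (he : RatFunc.X ^ e * x ∈ degSubring) :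
    RatFunc.X ^ e * x ∈ Algebra.adjoin ℤ {(RatFunc.X : RatFunc ℚ)⁻¹} := by
  have hX0 : (RatFunc.X : RatFunc ℚ) ≠ 0 := RatFunc.X_ne_zero
  have hx' : RatFunc.X ^ e * x = RatFunc.X ^ (e - a) * evX H := by
    rw [← hx, zpow_sub₀ hX0, zpow_natCast, div_mul_eq_mul_div, mul_comm x, mul_left_comm,
      mul_div_cancel_left₀ _ (pow_ne_zero a hX0)]
  rw [hx'] at he ⊢
  rcases eq_or_ne H 0 with rfl | hH
  · rw [map_zero, mul_zero]
    exact Subalgebra.zero_mem _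
  have hH0 : evX H ≠ 0 := by rwa [Ne, map_eq_zero_iff _ evX_injective]
  have hz : (RatFunc.X : RatFunc ℚ) ^ (e - a) ≠ 0 := zpow_ne_zero _ hX0
  have hd := (mem_degSubring.1 he).resolve_left (mul_ne_zero hz hH0)
  rw [RatFunc.intDegree_mul hz hH0, intDegree_X_zpow, intDegree_evX] at hd
  rw [evX_eq_sum, Finset.mul_sum]
  refine Subalgebra.sum_mem _ fun i hi => ?_
  have hi' := Finset.mem_range.1 hi
  rw [mul_left_comm, ← zpow_natCast, ← zpow_add₀ hX0]
  exact Subalgebra.mul_mem _ (intCast_mem_adjoin _) (X_zpow_mem_adjoin (by omega))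

end Laurent

/-! ### Cyclotomic denominators and integrality. -/

section Cyclotomic

open Polynomial (cyclotomic)

/-- The product of the first `n` cyclotomic polynomials. -/
def cycProd (n : ℕ) : Polynomial ℤ := ∏ m ∈ Finset.Icc 1 n, cyclotomic m ℤ

theorem cyclotomic_prime {m : ℕ} (hm : 0 < m) : Prime (cyclotomic m ℤ) :=
  (Polynomial.cyclotomic.irreducible hm).prime

theorem isRelPrime_cyclotomic {m m' : ℕ} (hm : 0 < m) (hm' : 0 < m') (h : m ≠ m') :
    IsRelPrime (cyclotomic m ℤ) (cyclotomic m' ℤ) := by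
  rw [(Polynomial.cyclotomic.irreducible hm).isRelPrime_iff_not_dvd]
  intro hd
  have := (Polynomial.cyclotomic.irreducible hm).associated_of_dvd
    (Polynomial.cyclotomic.irreducible hm') hd
  exact h (Polynomial.cyclotomic_injective (Polynomial.eq_of_monic_of_associated
    (Polynomial.cyclotomic.monic m ℤ) (Polynomial.cyclotomic.monic m' ℤ) this))

theorem cycProd_pow_dvd {n k : ℕ} {N : Polynomial ℤ}
    (h : ∀ m, 0 < m → m ≤ n → cyclotomic m ℤ ^ k ∣ N) : cycProd n ^ k ∣ N := by
  rw [cycProd, ← Finset.prod_pow]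
  refine Finset.prod_dvd_of_isRelPrime ?_ fun m hm => ?_
  · intro m hm m' hm' hne
    rw [Finset.coe_Icc, Set.mem_Icc] at hm hm'
    exact (isRelPrime_cyclotomic hm.1 hm'.1 hne).pow
  · rw [Finset.mem_Icc] at hm
    exact h m hm.1 hm.2

theorem X_pow_sub_one_dvd_cycProd {k n : ℕ} (hk : 0 < k) (hkn : k ≤ n) :
    (Polynomial.X ^ k - 1 : Polynomial ℤ) ∣ cycProd n := by
  rw [← Polynomial.prod_cyclotomic_eq_X_pow_sub_one hk, cycProd]
  refine Finset.prod_dvd_prod_of_subset _ _ _ fun d hd => ?_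
  rw [Finset.mem_Icc]
  exact ⟨Nat.pos_of_mem_divisors hd, (Nat.divisor_le hd).trans hkn⟩

theorem cycProd_ne_zero (n : ℕ) : cycProd n ≠ 0 :=
  Finset.prod_ne_zero_iff.2 fun m _ => Polynomial.cyclotomic_ne_zero m ℤ

/-- Reversal is multiplicative and sends X^m - 1 to its negative, so divisibility passes to the
numerator of d_n(1/q). -/
theorem cyclotomic_dvd_reverse_dPoly {m n : ℕ} (hm : 0 < m) (hmn : m ≤ n) :
    cyclotomic m ℤ ∣ (dPoly n).reverse := by
  obtain ⟨h, hh⟩ : (Polynomial.X ^ m - 1 : Polynomial ℤ) ∣ dPoly n :=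
    Finset.dvd_lcm (Finset.mem_Icc.2 ⟨hm, hmn⟩)
  have hrev : (Polynomial.X ^ m - 1 : Polynomial ℤ).reverse = -(Polynomial.X ^ m - 1) := by
    have hd : (Polynomial.X ^ m - 1 : Polynomial ℤ).natDegree = m := by
      rw [← Polynomial.C_1, Polynomial.natDegree_X_pow_sub_C]
    rw [Polynomial.reverse, hd, Polynomial.reflect_sub, Polynomial.reflect_monomial,
      Polynomial.reflect_one, Polynomial.revAt_le le_rfl, Nat.sub_self, pow_zero, neg_sub]
  rw [hh, Polynomial.reverse_mul_of_domain, hrev]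
  exact dvd_mul_of_dvd_left
    ((dvd_neg).2 (Polynomial.cyclotomic.dvd_X_pow_sub_one m ℤ)) _

/-- The rational functions whose denominator is a product of `X` and of cyclotomic polynomials
of index at most `n`. -/
def cycSubring (n : ℕ) : Subring (RatFunc ℚ) where
  carrier := {x | ∃ (t : ℕ) (N : Polynomial ℤ), x * evX (Polynomial.X * cycProd n) ^ t = evX N}
  zero_mem' := ⟨0, 0, by simp⟩
  one_mem' := ⟨0, 1, by simp⟩
  neg_mem' := by
    rintro x ⟨t, N, h⟩
    exact ⟨t, -N, by rw [map_neg, ← h]; ring⟩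
  mul_mem' := by
    rintro x y ⟨t, N, h⟩ ⟨t', N', h'⟩
    exact ⟨t + t', N * N', by rw [map_mul evX N, ← h, ← h']; ring⟩
  add_mem' := by
    rintro x y ⟨t, N, h⟩ ⟨t', N', h'⟩
    refine ⟨t + t', N * (Polynomial.X * cycProd n) ^ t' + N' * (Polynomial.X * cycProd n) ^ t, ?_⟩
    rw [map_add, map_mul evX N, map_mul evX N', ← h, ← h', map_pow, map_pow]
    ring

theorem X_zpow_mem_cycSubring (n : ℕ) (k : ℤ) : (RatFunc.X : RatFunc ℚ) ^ k ∈ cycSubring n := by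
  obtain ⟨k, rfl | rfl⟩ := k.eq_nat_or_neg
  · exact ⟨0, Polynomial.X ^ k, by simp [evX_X]⟩
  · refine ⟨k, cycProd n ^ k, ?_⟩
    have := pow_ne_zero k (RatFunc.X_ne_zero (K := ℚ))
    rw [map_mul, evX_X, mul_pow, map_pow, zpow_neg, zpow_natCast, inv_mul_cancel_left₀ this]

theorem one_sub_X_pow_inv_mem_cycSubring {n k : ℕ} (hk : 0 < k) (hkn : k ≤ n) :
    (1 - (RatFunc.X : RatFunc ℚ) ^ k)⁻¹ ∈ cycSubring n := by
  obtain ⟨h, hh⟩ := X_pow_sub_one_dvd_cycProd hk hkn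
  refine ⟨1, -(Polynomial.X * h), ?_⟩
  have h1 : 1 - (RatFunc.X : RatFunc ℚ) ^ k ≠ 0 := by
    rw [sub_ne_zero]
    exact_mod_cast (X_zpow_ne_one k (by omega)).symm
  rw [hh, pow_one, map_mul, map_mul, map_neg, map_mul, map_sub, map_pow, evX_X, map_one]
  field_simp
  ring

theorem one_sub_X_zpow_inv_mem_cycSubring {n : ℕ} {k : ℤ} (hk : k ≠ 0) (hkn : |k| ≤ n) :
    (1 - (RatFunc.X : RatFunc ℚ) ^ k)⁻¹ ∈ cycSubring n := by
  have hX0 : (RatFunc.X : RatFunc ℚ) ≠ 0 := RatFunc.X_ne_zero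
  have habs := abs_le.1 hkn
  have h := one_sub_X_pow_inv_mem_cycSubring (n := n) (k := k.natAbs) (by omega) (by omega)
  rw [← zpow_natCast] at h
  rcases lt_or_gt_of_ne hk with h0 | h0
  · rw [show (k.natAbs : ℤ) = -k by omega] at h
    have h2 : (1 - (RatFunc.X : RatFunc ℚ) ^ k)⁻¹
        = -(RatFunc.X ^ (-k) * (1 - (RatFunc.X : RatFunc ℚ) ^ (-k))⁻¹) := by
      have h3 : (1 - (RatFunc.X : RatFunc ℚ) ^ k)
          = RatFunc.X ^ k * -(1 - (RatFunc.X : RatFunc ℚ) ^ (-k)) := by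
        rw [mul_neg, mul_sub, ← zpow_add₀ hX0]
        simp
      rw [h3, mul_inv, inv_neg, zpow_neg]
      ring
    rw [h2]
    exact neg_mem (mul_mem (X_zpow_mem_cycSubring n _) h)
  · rwa [show (k.natAbs : ℤ) = k by omega] at h

theorem P0hat_mem_cycSubring {A r : ℕ} (hA : Even A) (hr : 1 ≤ r) (hAr : 2 * r < A) (n : ℕ) :
    P0hat A r n (RatFunc.X : RatFunc ℚ) ∈ cycSubring n := by
  have h := zpow_mul_P0hat_mem RatFunc.X_ne_zero X_zpow_ne_one hA hr hAr n (cycSubring n) 0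
    (fun j => X_zpow_mem_cycSubring n _) (fun k hk hkn s _ => by
      rw [div_eq_mul_inv, ← inv_pow]
      exact mul_mem (X_zpow_mem_cycSubring n k)
        (pow_mem (one_sub_X_zpow_inv_mem_cycSubring hk hkn) s))
    (fun s j hj => by
      rw [zpow_zero, one_mul]
      exact polarCoeff_mem X_zpow_ne_one A r n s hj _ (X_zpow_mem_cycSubring n)
        fun k hk hkn => one_sub_X_zpow_inv_mem_cycSubring hk hkn)
  rwa [zpow_zero, one_mul] at h

/-- The graph of the evaluation at `ζ` of the rational functions regular at `ζ`. -/
def evalGraph (ζ : ℂ) : Subring (RatFunc ℚ × ℂ) where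
  carrier := {p | ∃ a b : Polynomial ℤ, Polynomial.aeval ζ b ≠ 0 ∧ evX b * p.1 = evX a ∧
    Polynomial.aeval ζ b * p.2 = Polynomial.aeval ζ a}
  zero_mem' := ⟨0, 1, by simp⟩
  one_mem' := ⟨1, 1, by simp⟩
  neg_mem' := by
    rintro p ⟨a, b, hb, h1, h2⟩
    exact ⟨-a, b, hb, by simp [h1], by simp [h2]⟩
  mul_mem' := by
    rintro p p' ⟨a, b, hb, h1, h2⟩ ⟨a', b', hb', h1', h2'⟩
    refine ⟨a * a', b * b', by simp [hb, hb'], ?_, ?_⟩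
    · rw [map_mul, map_mul, ← h1, ← h1', Prod.fst_mul]
      ring
    · rw [map_mul, map_mul, ← h2, ← h2', Prod.snd_mul]
      ring
  add_mem' := by
    rintro p p' ⟨a, b, hb, h1, h2⟩ ⟨a', b', hb', h1', h2'⟩
    refine ⟨a * b' + a' * b, b * b', by simp [hb, hb'], ?_, ?_⟩
    · rw [map_mul, map_add, map_mul, map_mul, ← h1, ← h1', Prod.fst_add]
      ring
    · rw [map_mul, map_add, map_mul, map_mul, ← h2, ← h2', Prod.snd_add]
      ring

/-- The locality hypothesis `hT` of the reduction lemmas, for evaluation at ζ. -/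
theorem evalGraph_inv (ζ : ℂ) (x : RatFunc ℚ) (y : ℂ) (h : (x, y) ∈ evalGraph ζ) (hy : y ≠ 0) :
    x ≠ 0 ∧ (x⁻¹, y⁻¹) ∈ evalGraph ζ := by
  obtain ⟨a, b, hb, h1, h2⟩ := h
  simp only at h1 h2
  have ha : Polynomial.aeval ζ a ≠ 0 := h2 ▸ mul_ne_zero hb hy
  have ha0 : evX a ≠ 0 := by
    rw [Ne, map_eq_zero_iff _ evX_injective]
    rintro rfl
    simp at ha
  have hx : x ≠ 0 := by
    rintro rfl
    rw [mul_zero] at h1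
    exact ha0 h1.symm
  refine ⟨hx, b, a, ha, ?_, ?_⟩
  · simp only [← h1]
    field_simp
  · simp only [← h2]
    field_simp

theorem X_mem_evalGraph (ζ : ℂ) : ((RatFunc.X : RatFunc ℚ), ζ) ∈ evalGraph ζ :=
  ⟨Polynomial.X, 1, by simp, by simp [evX_X], by simp⟩

theorem cyclotomic_dvd_iff_aeval {m : ℕ} (hm : 0 < m) {ζ : ℂ} (hζ : IsPrimitiveRoot ζ m)
    (a : Polynomial ℤ) : cyclotomic m ℤ ∣ a ↔ Polynomial.aeval ζ a = 0 := by
  rw [Polynomial.cyclotomic_eq_minpoly hζ hm]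
  exact (minpoly.isIntegrallyClosed_dvd_iff (hζ.isIntegral hm) a).symm

/-- Φ_m is a simple factor: a double one would make the derivative mX^(m-1) vanish at a primitive
m-th root of unity. -/
theorem exists_X_pow_sub_one_eq_cyclotomic_mul {m : ℕ} (hm : 0 < m) :
    ∃ w : Polynomial ℤ, Polynomial.X ^ m - 1 = cyclotomic m ℤ * w ∧ ¬ cyclotomic m ℤ ∣ w := by
  obtain ⟨w, hw⟩ := Polynomial.cyclotomic.dvd_X_pow_sub_one m ℤ
  refine ⟨w, hw, fun hd => ?_⟩
  have hζ := Complex.isPrimitiveRoot_exp m hm.ne'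
  set ζ := Complex.exp (2 * Real.pi * Complex.I / m)
  have h1 := (cyclotomic_dvd_iff_aeval hm hζ _).1 dvd_rfl
  have h2 := (cyclotomic_dvd_iff_aeval hm hζ _).1 hd
  have h3 : Polynomial.aeval ζ (Polynomial.derivative (Polynomial.X ^ m - 1 : Polynomial ℤ)) = 0 := by
    rw [hw, Polynomial.derivative_mul, map_add, map_mul, map_mul, h1, h2]
    ring
  rw [Polynomial.derivative_sub, Polynomial.derivative_one, sub_zero,
    Polynomial.derivative_X_pow, map_mul, map_pow, Polynomial.aeval_X, Polynomial.aeval_C,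
    eq_intCast, Int.cast_natCast] at h3
  exact mul_ne_zero (by exact_mod_cast hm.ne') (pow_ne_zero _ (hζ.ne_zero hm.ne')) h3

/-- Starting from a denominator that is a power of X∏Φ_m, the vanishing of (1-q^m)^A P̂₀ at ζ bounds
the Φ_m-adic pole order by A-1 for each m ≤ n. Because the Φ_m are non-associated primes of ℤ[X],
the bounds combine over ℤ. -/
theorem exists_pow_mul_P0hat_eq {A r : ℕ} (hA : Even A) (hr : 1 ≤ r) (hAr : 2 * r < A) (n : ℕ) :
    ∃ (t : ℕ) (N : Polynomial ℤ),
      RatFunc.X ^ t * evX (cycProd n) ^ (A - 1) * P0hat A r n RatFunc.X = evX N := by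
  obtain ⟨t, N, hN⟩ := P0hat_mem_cycSubring hA hr hAr n
  set P := P0hat A r n (RatFunc.X : RatFunc ℚ) with hP
  set M : Polynomial ℤ := Polynomial.X * cycProd n with hM
  -- The extra M^A allows cancelling the (t+1)-st power of the cyclotomic product, leaving exponent
  -- (t+A) - (t+1) = A-1.
  have hN' : P * evX M ^ (t + A) = evX (N * M ^ A) := by
    rw [pow_add, ← mul_assoc, hN, map_mul evX N, map_pow]
  have hdvd : cycProd n ^ (t + 1) ∣ N * M ^ A := by
    refine cycProd_pow_dvd fun m hm hmn => ?_
    have hζ := Complex.isPrimitiveRoot_exp m hm.ne'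
    set ζ := Complex.exp (2 * Real.pi * Complex.I / m)
    obtain ⟨a, b, hb, h1, h2⟩ := pair_pow_mul_P0hat_mem (evalGraph_inv ζ) (X_mem_evalGraph ζ) hζ
      hm X_zpow_ne_one hA hr hAr n
    simp only [mul_zero] at h1 h2
    rw [Ne, ← cyclotomic_dvd_iff_aeval hm hζ] at hb
    obtain ⟨a', ha'⟩ := (cyclotomic_dvd_iff_aeval hm hζ a).2 h2.symm
    obtain ⟨w, hw, hw'⟩ := exists_X_pow_sub_one_eq_cyclotomic_mul hm
    obtain ⟨g, hg⟩ : cyclotomic m ℤ ∣ cycProd n :=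
      Finset.dvd_prod_of_mem _ (Finset.mem_Icc.2 ⟨hm, hmn⟩)
    have hp := cyclotomic_prime hm
    set Φ := cyclotomic m ℤ
    have hpoly : b * (Φ * w) ^ A * (N * M ^ A) = Φ * a' * M ^ (t + A) := by
      apply evX_injective
      rw [← ha', ← hw, map_mul, ← hN', map_mul evX a, ← h1, map_mul, map_pow, map_sub, map_pow,
        evX_X, map_one, map_pow, ← hP, ← hA.neg_pow (RatFunc.X ^ m - 1), neg_sub]
      ring
    have h3 : Φ ^ A * Φ ^ (t + 1) ∣ Φ ^ A * (b * w ^ A * (N * M ^ A)) := by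
      refine ⟨a' * (Polynomial.X * g) ^ (t + A), ?_⟩
      calc Φ ^ A * (b * w ^ A * (N * M ^ A)) = b * (Φ * w) ^ A * (N * M ^ A) := by ring
        _ = Φ * a' * (Polynomial.X * (Φ * g)) ^ (t + A) := by rw [hpoly, hM, hg]
        _ = _ := by ring
    have h4 := (mul_dvd_mul_iff_left (pow_ne_zero A hp.ne_zero)).1 h3
    refine hp.pow_dvd_of_dvd_mul_left _ (fun h => ?_) h4
    rcases hp.dvd_or_dvd h with h | h
    · exact hb h
    · exact hw' (hp.dvd_of_dvd_pow h)
  obtain ⟨N', hN''⟩ := hdvd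
  refine ⟨t + A, N', ?_⟩
  have h0 : evX (cycProd n) ^ (t + 1) ≠ 0 :=
    pow_ne_zero _ (by rw [Ne, map_eq_zero_iff _ evX_injective]; exact cycProd_ne_zero n)
  apply mul_left_cancel₀ h0
  rw [← map_pow, ← map_mul, ← hN'', ← hN', hM, map_mul, evX_X, map_pow]
  obtain ⟨d, hd⟩ := Nat.exists_eq_add_of_le' (show 1 ≤ A by omega)
  rw [show A - 1 = d by omega, hd]
  ring

theorem exists_aeval_inv_dPoly_eq (n : ℕ) : ∃ (a : ℕ) (g : Polynomial ℤ),
    Polynomial.aeval (RatFunc.X : RatFunc ℚ)⁻¹ (dPoly n) * RatFunc.X ^ a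
      = evX (g * cycProd n) := by
  have hX0 : (RatFunc.X : RatFunc ℚ) ≠ 0 := RatFunc.X_ne_zero
  obtain ⟨g, hg⟩ : cycProd n ^ 1 ∣ (dPoly n).reverse :=
    cycProd_pow_dvd fun m hm hmn => by simpa using cyclotomic_dvd_reverse_dPoly hm hmn
  refine ⟨(dPoly n).natDegree, g, ?_⟩
  rw [mul_comm g, ← pow_one (cycProd n), ← hg]
  let _ : Invertible (RatFunc.X : RatFunc ℚ)⁻¹ := invertibleOfNonzero (inv_ne_zero hX0)
  have h := Polynomial.eval₂_reverse_mul_pow (algebraMap ℤ (RatFunc ℚ)) (RatFunc.X⁻¹) (dPoly n)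
  rw [invOf_eq_inv, inv_inv] at h
  rw [Polynomial.aeval_def, ← h, mul_assoc, ← mul_pow, inv_mul_cancel₀ hX0, one_pow, mul_one]
  rfl

end Cyclotomic

end QDenominators

end

/-! ### Combination of the degree bound with integrality. -/

theorem mainTheorem3 (A r : ℕ) (hA : Even A) (hr : 1 ≤ r) (hAr : 2 * r < A) :
    ∃ β γ : ℝ, ∀ n : ℕ,
      (RatFunc.X : RatFunc ℚ) ^
          ⌊(-(A : ℝ) / 8 - (r : ℝ) ^ 2 / 2) * (n : ℝ) ^ 2 + β * (n : ℝ) + γ⌋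
        * Polynomial.aeval (RatFunc.X : RatFunc ℚ)⁻¹ (QDenominators.dPoly n) ^ (A - 1)
        * QDenominators.P0hat A r n (RatFunc.X : RatFunc ℚ)
      ∈ Algebra.adjoin ℤ {(RatFunc.X : RatFunc ℚ)⁻¹} := by
  -- β = -2 offsets the linear term 2n of `growthExp_le`; the factor d_n(1/q) has degree at most 0
  -- and needs no compensation.
  refine ⟨-2, 0, fun n => ?_⟩
  set e := ⌊(-(A : ℝ) / 8 - (r : ℝ) ^ 2 / 2) * (n : ℝ) ^ 2 + -2 * (n : ℝ) + 0⌋ with he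
  have hdeg := QDenominators.zpow_mul_P0hat_mem_degSubring hA hr hAr n (e := e) fun j hj => by
    have h1 := QDenominators.growthExp_le hA hr hAr n hj
    have h2 := Int.floor_le ((-(A : ℝ) / 8 - (r : ℝ) ^ 2 / 2) * (n : ℝ) ^ 2 + -2 * (n : ℝ) + 0)
    rw [← he] at h2
    have h3 : ((e + QDenominators.growthExp A r n j : ℤ) : ℝ) ≤ 0 := by
      push_cast
      linarith
    exact_mod_cast h3
  obtain ⟨t, N, hN⟩ := QDenominators.exists_pow_mul_P0hat_eq hA hr hAr n
  obtain ⟨a, g, hg⟩ := QDenominators.exists_aeval_inv_dPoly_eq n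
  have hd : Polynomial.aeval (RatFunc.X : RatFunc ℚ)⁻¹ (QDenominators.dPoly n)
      ∈ QDenominators.degSubring := by
    rw [Polynomial.aeval_eq_sum_range]
    refine sum_mem fun i _ => ?_
    rw [Algebra.smul_def, eq_intCast]
    exact mul_mem (intCast_mem _ _) (pow_mem QDenominators.X_inv_mem_degSubring i)
  rw [mul_assoc]
  refine QDenominators.mem_adjoin_X_inv (a := a * (A - 1) + t) (H := g ^ (A - 1) * N) ?_ ?_
  · rw [map_mul, map_pow, ← hN]
    rw [map_mul] at hg
    calc _ = (Polynomial.aeval (RatFunc.X : RatFunc ℚ)⁻¹ (QDenominators.dPoly n)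
          * RatFunc.X ^ a) ^ (A - 1) * RatFunc.X ^ t
          * QDenominators.P0hat A r n (RatFunc.X : RatFunc ℚ) := by ring
      _ = _ := by rw [hg]; ring
  · rw [mul_left_comm]
    exact mul_mem (pow_mem hd _) hdeg
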